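/- Let $G=(T_1,T_2,S,E,\mathbf M_1,\mathbf M_2)$ be an instance of the basic path-matching problem: $(T_1\cup T_2\cup S,E)$ is a finite simple graph, the sets $T_1,T_2,S$ are pairwise disjoint, $T_1$ and $T_2$ are stable sets with $|T_1|=|T_2|=t$, and each $\mathbf M_i$ is a matroid on $T_i$, both of the same rank $r$. Let $\mathbb F$ be a field, let $Q_1$ be an $r\times t$ matrix over $\mathbb F$ whose columns represent $\mathbf M_1$, and let $Q_2$ be a $t\times r$ matrix over $\mathbb F$ whose rows represent $\mathbf M_2$. A *path-matching* is the edge set of a collection of node-disjoint paths, each with one endpoint in $T_1$, the other in $T_2$ and all internal vertices in $S$, together with a matching on the $S$-vertices not contained in any of the paths. A *partial path-matching* is defined in the same way, except that each path may join $T_1$ to $T_2$, or $T_1$ to $S$, or $T_2$ to $S$ (again with all internal vertices in $S$). The *matching edges* of a partial path-matching are the edges of its matching, that is, its edges that have both ends in $S$ and meet no other edge of it. For a set $M$ of edges let $\partial_iM\subseteq T_i$ and $\partial_SM\subseteq S$ be the sets of vertices of $T_i$ and $S$ covered by $M$. A *basic path-matching* is a path-matching $M$ such that $\partial_iM$ is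 a basis of $\mathbf M_i$ for $i=1,2$ and $\partial_SM=S$. A partial path-matching $M$ is *extensible* if there is a basic path-matching $M'\supseteq M$ such that every matching edge of $M$ is a matching edge of $M'$. Let $X$ be the matrix with rows indexed by $T_1\cup S$ and columns indexed by $T_2\cup S$, with $X_{i,j}=\pm x_{\{i,j\}}$ if $\{i,j\}\in E$ and $X_{i,j}=0$ otherwise, where the $x_e$ are distinct indeterminates and the signs are chosen so that $X[S,S]$ is skew-symmetric. For a partial path-matching $M$ let $\overline{\partial_iM}=T_i\setminus\partial_iM$ and $S'=S\setminus\partial_SM$, let $C_i$ be the set of the endpoints in $S$ of those paths of $M$ that join $T_i$ to $S$, and let $D_i$ be a diagonal matrix, with rows and columns indexed by $\overline{\partial_iM}$, whose diagonal entries are indeterminates, all indeterminates of $D_1$, $D_2$ and $X$ being distinct. Put $$ Z(M) = \begin{pmatrix} 0 & Q_1[*,\partial_1 M] & Q_1[*,\overline{\partial_1 M}] & 0 & 0\\ Q_2[\partial_2 M,*] & 0 & 0 & 0 & 0\\ Q_2[\overline{\partial_2 M},*] & 0 & 0 & D_2 & 0\\ 0 & 0 & D_1 & X[\overline{\partial_1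 M},\overline{\partial_2 M}] & X[\overline{\partial_1 M},C_2\cup S']\\ 0 & 0 & 0 & X[C_1\cup S',\overline{\partial_2 M}] & X[C_1\cup S',C_2\cup S'] \end{pmatrix}. $$ Then a partial path-matching $M$ is extensible if and only if $Z(M)$ is non-singular (over the field of rational functions over $\mathbb F$ in the indeterminates). -/

import Mathlib

/-- An instance `G = (T₁, T₂, S, E, M₁, M₂)` of the basic path-matching problem: a finite simple
graph whose vertex set is partitioned into `T₁`, `T₂`, `S` with `T₁`, `T₂` stable and of equal size,
together with matroids `M₁` on `T₁` and `M₂` on `T₂` of the same rank `r`. -/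
structure BPMInstance (V : Type*) [Finite V] where
  graph : SimpleGraph V
  T₁ : Set V
  T₂ : Set V
  S : Set V
  disjoint_T₁_T₂ : Disjoint T₁ T₂
  disjoint_T₁_S : Disjoint T₁ S
  disjoint_T₂_S : Disjoint T₂ S
  cover : T₁ ∪ T₂ ∪ S = Set.univ
  stable₁ : ∀ u ∈ T₁, ∀ v ∈ T₁, ¬ graph.Adj u v
  stable₂ : ∀ u ∈ T₂, ∀ v ∈ T₂, ¬ graph.Adj u v
  card_eq : T₁.ncard = T₂.ncard
  M₁ : Matroid V
  M₂ : Matroid V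
  ground₁ : M₁.E = T₁
  ground₂ : M₂.E = T₂
  r : ℕ
  rank₁ : M₁.eRank = r
  rank₂ : M₂.eRank = r

namespace BPMInstance

variable {V : Type*} [Finite V] (G : BPMInstance V)

/-- The walk `p` of `G` is one of the paths that make up the edge set `M`: it is a path, all of its
edges lie in `M`, no other edge of `M` meets it, and its internal vertices lie in `S`. -/
def IsPathOf (M : Set (Sym2 V)) {u v : V} (p : G.graph.Walk u v) : Prop :=
  p.IsPath ∧ (∀ e ∈ p.edges, e ∈ M) ∧
    (∀ e ∈ M, ∀ w ∈ p.support, w ∈ e → e ∈ p.edges) ∧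
    ∀ w ∈ p.support, w = u ∨ w = v ∨ w ∈ G.S

/-- The vertices of `T₁` covered by `M`. -/
def bd₁ (M : Set (Sym2 V)) : Set V := {v ∈ G.T₁ | ∃ e ∈ M, v ∈ e}

/-- The vertices of `T₂` covered by `M`. -/
def bd₂ (M : Set (Sym2 V)) : Set V := {v ∈ G.T₂ | ∃ e ∈ M, v ∈ e}

/-- The vertices of `S` covered by `M`. -/
def bdS (M : Set (Sym2 V)) : Set V := {v ∈ G.S | ∃ e ∈ M, v ∈ e}

/-- The edges of `M` that have both ends in `S` and meet no other edge of `M`. For a path-matching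
this is the matching on the `S`-vertices not contained in any of the paths. -/
def matchingPart (M : Set (Sym2 V)) : Set (Sym2 V) :=
  {e ∈ M | (∀ w ∈ e, w ∈ G.S) ∧ ∀ f ∈ M, ∀ w ∈ e, w ∈ f → f = e}

/-- `M` is (the edge set of) a path-matching: a collection of node-disjoint paths with one endpoint
in `T₁` and the other in `T₂`, whose internal vertices lie in `S`, together with a matching on the
`S`-vertices not contained in any of the paths. -/
def IsPathMatching (M : Set (Sym2 V)) : Prop :=
  M ⊆ G.graph.edgeSet ∧ ∀ e ∈ M, e ∈ G.matchingPart M ∨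
    ∃ u ∈ G.T₁, ∃ v ∈ G.T₂, ∃ p : G.graph.Walk u v, G.IsPathOf M p ∧ e ∈ p.edges

/-- `M` is a basic path-matching. -/
def IsBasicPathMatching (M : Set (Sym2 V)) : Prop :=
  G.IsPathMatching M ∧ G.M₁.IsBase (G.bd₁ M) ∧ G.M₂.IsBase (G.bd₂ M) ∧ G.bdS M = G.S

/-- `M` is a partial path-matching: the edge set of a collection of node-disjoint paths with internal
vertices in `S`, each joining `T₁` to `T₂`, or `T₁` to `S`, or `T₂` to `S`, together with a matching
on the `S`-vertices not contained in any of the paths. -/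
def IsPartialPathMatching (M : Set (Sym2 V)) : Prop :=
  M ⊆ G.graph.edgeSet ∧ ∀ e ∈ M, e ∈ G.matchingPart M ∨
    ∃ (u v : V) (p : G.graph.Walk u v),
      (u ∈ G.T₁ ∧ v ∈ G.T₂ ∨ u ∈ G.T₁ ∧ v ∈ G.S ∨ u ∈ G.T₂ ∧ v ∈ G.S) ∧
        G.IsPathOf M p ∧ e ∈ p.edges

/-- `M` is extensible: it is contained in a basic path-matching `M'`, where containment is that of
(partial) path-matchings, i.e. the matching edges of `M` are matching edges of `M'`. -/
def IsExtensible (M : Set (Sym2 V)) : Prop :=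
  ∃ M' : Set (Sym2 V), G.IsBasicPathMatching M' ∧ M ⊆ M' ∧ G.matchingPart M ⊆ G.matchingPart M'

/-- `C₁`: the endpoints in `S` of the paths of `M` with one endpoint in `T₁` and the other in `S`. -/
def C₁ (M : Set (Sym2 V)) : Set V :=
  {c ∈ G.S | ∃ u ∈ G.T₁, ∃ p : G.graph.Walk u c, G.IsPathOf M p}

/-- `C₂`: the endpoints in `S` of the paths of `M` with one endpoint in `T₂` and the other in `S`. -/
def C₂ (M : Set (Sym2 V)) : Set V :=
  {c ∈ G.S | ∃ u ∈ G.T₂, ∃ p : G.graph.Walk u c, G.IsPathOf M p}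

/-- The columns of the `r × T₁` matrix `Q₁` represent `M₁`. -/
def Represents₁ {F : Type*} [Field F] (Q₁ : Matrix (Fin G.r) G.T₁ F) : Prop :=
  ∀ J : Set G.T₁, G.M₁.Indep (Subtype.val '' J) ↔ LinearIndepOn F (fun v i => Q₁ i v) J

/-- The rows of the `T₂ × r` matrix `Q₂` represent `M₂`. -/
def Represents₂ {F : Type*} [Field F] (Q₂ : Matrix G.T₂ (Fin G.r) F) : Prop :=
  ∀ J : Set G.T₂, G.M₂.Indep (Subtype.val '' J) ↔ LinearIndepOn F (fun v i => Q₂ v i) J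

/-- The indeterminates: one for each edge, and one for each entry of the diagonal matrices `D₁`
and `D₂`. -/
inductive Indet (V : Type*) where
  | edge (e : Sym2 V)
  | diag₁ (v : V)
  | diag₂ (v : V)

/-- A choice of signs for which `X[S,S]` is skew-symmetric. -/
def IsSkewSign (sgn : V → V → ℤˣ) : Prop :=
  ∀ i ∈ G.S, ∀ j ∈ G.S, G.graph.Adj i j → sgn j i = - sgn i j

open Classical in
/-- The matrix of indeterminates `X`, with entry `± x_{ij}` if `ij` is an edge and `0` otherwise.
Only its rows in `T₁ ∪ S` and its columns in `T₂ ∪ S` are ever used. -/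
noncomputable def X (F : Type*) [Field F] (sgn : V → V → ℤˣ) :
    Matrix V V (MvPolynomial (Indet V) F) :=
  Matrix.of fun i j =>
    if G.graph.Adj i j then ((sgn i j : ℤ) : MvPolynomial (Indet V) F) *
      MvPolynomial.X (Indet.edge s(i, j)) else 0

/-- The row index set of `Z(M)`, block by block. -/
abbrev ZRow (M : Set (Sym2 V)) : Type _ :=
  Fin G.r ⊕ ↥(G.bd₂ M) ⊕ ↥(G.T₂ \ G.bd₂ M) ⊕ ↥(G.T₁ \ G.bd₁ M) ⊕ ↥(G.C₁ M ∪ (G.S \ G.bdS M))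

/-- The column index set of `Z(M)`, block by block. -/
abbrev ZCol (M : Set (Sym2 V)) : Type _ :=
  Fin G.r ⊕ ↥(G.bd₁ M) ⊕ ↥(G.T₁ \ G.bd₁ M) ⊕ ↥(G.T₂ \ G.bd₂ M) ⊕ ↥(G.C₂ M ∪ (G.S \ G.bdS M))

open Classical in
/-- The matrix `Z(M)`, given block row by block row. -/
noncomputable def Z {F : Type*} [Field F] (Q₁ : Matrix (Fin G.r) G.T₁ F)
    (Q₂ : Matrix G.T₂ (Fin G.r) F) (sgn : V → V → ℤˣ) (M : Set (Sym2 V)) :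
    Matrix (G.ZRow M) (G.ZCol M) (MvPolynomial (Indet V) F) :=
  Matrix.of fun i j => match i, j with
    | .inl k, .inr (.inl v) => MvPolynomial.C (Q₁ k ⟨v.1, v.2.1⟩)
    | .inl k, .inr (.inr (.inl v)) => MvPolynomial.C (Q₁ k ⟨v.1, v.2.1⟩)
    | .inl _, _ => 0
    | .inr (.inl u), .inl k => MvPolynomial.C (Q₂ ⟨u.1, u.2.1⟩ k)
    | .inr (.inl _), _ => 0
    | .inr (.inr (.inl u)), .inl k => MvPolynomial.C (Q₂ ⟨u.1, u.2.1⟩ k)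
    | .inr (.inr (.inl u)), .inr (.inr (.inr (.inl v))) =>
        if u = v then MvPolynomial.X (Indet.diag₂ u.1) else 0
    | .inr (.inr (.inl _)), _ => 0
    | .inr (.inr (.inr (.inl u))), .inr (.inr (.inl v)) =>
        if u = v then MvPolynomial.X (Indet.diag₁ u.1) else 0
    | .inr (.inr (.inr (.inl u))), .inr (.inr (.inr (.inl v))) => G.X F sgn u.1 v.1
    | .inr (.inr (.inr (.inl u))), .inr (.inr (.inr (.inr v))) => G.X F sgn u.1 v.1
    | .inr (.inr (.inr (.inl _))), _ => 0
    | .inr (.inr (.inr (.inr u))), .inr (.inr (.inr (.inl v))) => G.X F sgn u.1 v.1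
    | .inr (.inr (.inr (.inr u))), .inr (.inr (.inr (.inr v))) => G.X F sgn u.1 v.1
    | .inr (.inr (.inr (.inr _))), _ => 0

/-- A matrix over an integral domain, with rows and columns indexed by arbitrary types, is
non-singular (over the field of fractions): it is square and, for an ordering of its rows and of its
columns, its determinant is not zero. (The determinant changes only in sign with the orderings.) -/
def IsNonsingular {m n R : Type*} [CommRing R] (A : Matrix m n R) : Prop :=
  ∃ (k : ℕ) (e : Fin k ≃ m) (f : Fin k ≃ n), (A.submatrix e f).det ≠ 0

end BPMInstance

/-! Orient the paths from $T_1$ towards $T_2$ and traverse each matching edge both ways. A basic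
path-matching $M'$ then becomes a bijection $\partial_1M'\cup S\to\partial_2M'\cup S$ along edges
whose only cycles are 2-cycles. Conversely, any such bijection between $A\cup S$ and $B\cup S$ with
$A\subseteq T_1$, $B\subseteq T_2$ comes from a path-matching covering exactly $A$, $B$ and $S$
(`IsSuccessor`, `IsSuccessor.isPathMatching`). For a partial $M$ the $X$-part of $Z(M)$ has a row
for each vertex that may still need a successor and a column for each that may still need a
predecessor; the entries of $D_1$, $D_2$ let an uncovered terminal stay uncovered.

If $M'$ extends $M$, specialize each edge variable to the indicator of $M'$ and each diagonal
variable to $1$ exactly when its terminal is missed by $M'$. The specialized matrix has trivial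
kernel: the two bases dispose of the $Q$-blocks, and the $X$-block is solved by induction along the
paths of $M'$ (`IsSuccessor.eq_zero_of_forall_sum`).

Conversely, multilinearity lets each row commit to its entries inside or outside $D_1,D_2$ while
keeping the determinant nonzero. These commitments determine the candidate bases; a dependency in
$Q_1$ or $Q_2$ among their elements would be a kernel vector, and counting along a transversal shows
that they are large enough. As $X$ is alternating on the vertices of $S$ missed by $M$, permutations
with an odd cycle there cancel in pairs, and even cycles can be replaced by 2-cycles. A suitable
transversal, joined to the successor map of $M$, therefore has only 2-cycles: any other cycle would
have to pass through the old paths, where a rank function forbids it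
(`IsPartialPathMatching.exists_isSuccessor_of_transversal`). -/

namespace Equiv.Perm

/-! ### Reversing one cycle of a permutation -/

variable {n : Type*} [Fintype n] [DecidableEq n]

open Classical in
/-- The permutation `π` with its cycle through `i` reversed. -/
noncomputable def reverseCycle (π : Perm n) (i : n) : Perm n :=
  π * (π.cycleOf i)⁻¹ * (π.cycleOf i)⁻¹

open Classical in
theorem reverseCycle_apply (π : Perm n) (i j : n) :
    π.reverseCycle i j = if π.SameCycle i j then π⁻¹ j else π j := by
  have h1 : ∀ j, (π.cycleOf i)⁻¹ j = if π.SameCycle i j then π⁻¹ j else j := by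
    intro j
    rw [cycleOf_inv, cycleOf_apply]
    simp only [sameCycle_inv]
  simp only [reverseCycle, Perm.mul_apply, h1]
  split_ifs with h h' <;> simp_all

theorem sign_reverseCycle (π : Perm n) (i : n) : sign (π.reverseCycle i) = sign π := by
  simp [reverseCycle, mul_assoc]

theorem reverseCycle_pow_of_sameCycle (π : Perm n) (i : n) (m : ℕ) :
    ((π.reverseCycle i) ^ m) i = (π⁻¹ ^ m) i := by
  classical
  induction m with
  | zero => simp
  | succ m ih =>
    rw [pow_succ', Perm.mul_apply, ih, reverseCycle_apply, if_pos, pow_succ', Perm.mul_apply]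
    exact ⟨-m, by simp⟩

theorem reverseCycle_pow_of_not_sameCycle (π : Perm n) {i a : n} (h : ¬ π.SameCycle i a) (m : ℕ) :
    ((π.reverseCycle i) ^ m) a = (π ^ m) a := by
  classical
  induction m with
  | zero => simp
  | succ m ih =>
    rw [pow_succ', Perm.mul_apply, ih, reverseCycle_apply, if_neg, pow_succ', Perm.mul_apply]
    intro h'
    exact h (h'.trans (SameCycle.symm ⟨m, by simp⟩))

/-- Reversal keeps the partition into cycles, so data read off from that partition select the same
cycle before and after. -/
theorem sameCycle_reverseCycle (π : Perm n) (i a b : n) :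
    (π.reverseCycle i).SameCycle a b ↔ π.SameCycle a b := by
  classical
  have key : ∀ b, π.SameCycle i b → (π.reverseCycle i).SameCycle i b := by
    intro b hb
    obtain ⟨m, hm⟩ := (sameCycle_inv.2 hb).exists_nat_pow_eq
    exact ⟨m, by rw [zpow_natCast, reverseCycle_pow_of_sameCycle, hm]⟩
  constructor
  · intro h
    obtain ⟨m, rfl⟩ := h.exists_nat_pow_eq
    clear h
    induction m with
    | zero => exact SameCycle.refl _ _
    | succ m ih =>
      refine ih.trans ?_
      rw [pow_succ', Perm.mul_apply, reverseCycle_apply]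
      split_ifs
      · exact ⟨-1, by simp⟩
      · exact ⟨1, by simp⟩
  · intro h
    by_cases ha : π.SameCycle i a
    · exact (key a ha).symm.trans (key b (ha.trans h))
    · obtain ⟨m, hm⟩ := h.exists_nat_pow_eq
      exact ⟨m, by rw [zpow_natCast, reverseCycle_pow_of_not_sameCycle π ha, hm]⟩

theorem reverseCycle_reverseCycle (π : Perm n) (i : n) :
    (π.reverseCycle i).reverseCycle i = π := by
  classical
  ext j
  rw [reverseCycle_apply]
  simp only [sameCycle_reverseCycle]
  split_ifs with h
  · rw [Perm.inv_eq_iff_eq, reverseCycle_apply, if_pos]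
    · simp
    · exact h.trans ⟨1, by simp⟩
  · rw [reverseCycle_apply, if_neg h]

open Classical in
/-- The finite set of elements on the cycle of `π` through `i`. -/
noncomputable def cycleFinset (π : Perm n) (i : n) : Finset n :=
  Finset.univ.filter (π.SameCycle i)

theorem mem_cycleFinset {π : Perm n} {i j : n} : j ∈ π.cycleFinset i ↔ π.SameCycle i j := by
  simp [cycleFinset]

theorem isCycleOn_cycleFinset (π : Perm n) (i : n) : π.IsCycleOn (π.cycleFinset i) := by
  refine ⟨⟨?_, π.injective.injOn, ?_⟩, ?_⟩
  · intro j hj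
    rw [Finset.mem_coe, mem_cycleFinset] at hj ⊢
    exact hj.trans ⟨1, by simp⟩
  · intro j hj
    rw [Finset.mem_coe, mem_cycleFinset] at hj
    exact ⟨π⁻¹ j, by rw [Finset.mem_coe, mem_cycleFinset]; exact hj.trans ⟨-1, by simp⟩, by simp⟩
  · intro a ha b hb
    rw [Finset.mem_coe, mem_cycleFinset] at ha hb
    exact ha.symm.trans hb

/-- The elements whose cycle has odd length and lies in `W`. -/
def oddCycles (W : Set n) (π : Perm n) : Set n :=
  {i | (∀ j, π.SameCycle i j → j ∈ W) ∧ Odd (π.cycleFinset i).card}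

theorem oddCycles_reverseCycle (W : Set n) (π : Perm n) (i : n) :
    oddCycles W (π.reverseCycle i) = oddCycles W π := by
  simp [oddCycles, cycleFinset, sameCycle_reverseCycle]

end Equiv.Perm

/-! ### Cancellation of odd cycles in alternating determinants -/

namespace Matrix

open Equiv

variable {n R : Type*} [Fintype n] [DecidableEq n] [CommRing R]

/-- Reindexing along the cycle turns $\prod A_{j,\pi^{-1}j}$ into $\prod A_{\pi j,j}$; skew-symmetry
then gives one sign per element of a cycle of odd length. -/
theorem prod_reverseCycle (A : Matrix n n R) (W : Set n)
    (hskew : ∀ i ∈ W, ∀ j ∈ W, A j i = - A i j) {π : Perm n} {i : n}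
    (hi : i ∈ Perm.oddCycles W π) :
    ∏ j, A j (π.reverseCycle i j) = - ∏ j, A j (π j) := by
  classical
  have hsplit : ∀ f : n → R, ∏ j, f j =
      (∏ j ∈ π.cycleFinset i, f j) * ∏ j ∈ (π.cycleFinset i)ᶜ, f j := fun f =>
    (Finset.prod_mul_prod_compl _ _).symm
  rw [hsplit, hsplit (fun j => A j (π j)), ← neg_mul]
  congr 1
  · have h1 : ∏ j ∈ π.cycleFinset i, A j (π.reverseCycle i j) =
        ∏ j ∈ π.cycleFinset i, A j (π⁻¹ j) := by
      refine Finset.prod_congr rfl fun j hj => ?_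
      rw [Perm.reverseCycle_apply, if_pos (Perm.mem_cycleFinset.1 hj)]
    have h2 : ∏ j ∈ π.cycleFinset i, A j (π⁻¹ j) = ∏ j ∈ π.cycleFinset i, A (π j) j := by
      symm
      refine Finset.prod_bij (fun j _ => π j) ?_ ?_ ?_ ?_
      · intro j hj
        rw [Perm.mem_cycleFinset] at hj ⊢
        exact hj.trans ⟨1, by simp⟩
      · intro a _ b _ h
        exact π.injective h
      · intro j hj
        rw [Perm.mem_cycleFinset] at hj
        exact ⟨π⁻¹ j, Perm.mem_cycleFinset.2 (hj.trans ⟨-1, by simp⟩), by simp⟩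
      · intro j _
        simp
    have h3 : ∏ j ∈ π.cycleFinset i, A (π j) j = ∏ j ∈ π.cycleFinset i, - A j (π j) := by
      refine Finset.prod_congr rfl fun j hj => ?_
      rw [Perm.mem_cycleFinset] at hj
      exact hskew _ (hi.1 _ hj) _ (hi.1 _ (hj.trans ⟨1, by simp⟩))
    rw [h1, h2, h3, Finset.prod_neg, hi.2.neg_one_pow, neg_one_mul]
  · refine Finset.prod_congr rfl fun j hj => ?_
    rw [Finset.mem_compl, Perm.mem_cycleFinset] at hj
    rw [Perm.reverseCycle_apply, if_neg hj]

/-- In the expansion of the determinant of a matrix that is alternating on `W`, the permutations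
with an odd cycle inside `W` cancel. -/
theorem exists_perm_oddCycles_eq_empty (A : Matrix n n R) (W : Set n)
    (hskew : ∀ i ∈ W, ∀ j ∈ W, A j i = - A i j) (hdiag : ∀ i ∈ W, A i i = 0) (hdet : A.det ≠ 0) :
    ∃ π : Perm n, (∀ i, A i (π i) ≠ 0) ∧ Perm.oddCycles W π = ∅ := by
  classical
  set f : Perm n → R := fun π => (Perm.sign π : ℤ) * ∏ i, A i (π i) with hf
  have hdet' : A.det = ∑ π, f π := by
    rw [← det_transpose, det_apply']
    rfl
  have hsum : ∑ π with (Perm.oddCycles W π).Nonempty, f π = 0 := by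
    -- The base point depends on the set of odd-cycle elements alone, not on the permutation.
    -- Reversal preserves this set, so applying it twice reverses the same cycle twice.
    let c : (s : Set n) → s.Nonempty → n := fun s h => h.choose
    have hc : ∀ (s t : Set n) (hs : s.Nonempty) (ht : t.Nonempty), s = t → c s hs = c t ht := by
      rintro s _ hs ht rfl
      rfl
    have hmem : ∀ (s : Set n) (hs : s.Nonempty), c s hs ∈ s := fun s hs => hs.choose_spec
    have key : ∀ (π : Perm n) (h : (Perm.oddCycles W π).Nonempty),
        f π + f (π.reverseCycle (c _ h)) = 0 := by
      intro π h
      simp only [hf]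
      rw [Perm.sign_reverseCycle, prod_reverseCycle A W hskew (hmem _ h)]
      ring
    refine Finset.sum_involution
      (fun π hπ => π.reverseCycle (c _ (Finset.mem_filter.1 hπ).2)) ?_ ?_ ?_ ?_
    · intro π hπ
      exact key π _
    · intro π hπ hne heq
      have h := (Finset.mem_filter.1 hπ).2
      have hi := hmem _ h
      set i := c _ h
      -- A permutation fixed by the reversal has $\pi^2 i=i$, so the odd cycle is a fixed point and
      -- its term already vanishes because the diagonal is zero. This is where characteristic 2
      -- needs alternating rather than skew-symmetric.
      have h1 : π.reverseCycle i i = π i := by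
        have : π.reverseCycle i = π := heq
        rw [this]
      rw [Perm.reverseCycle_apply, if_pos (Perm.SameCycle.refl _ _)] at h1
      have h2 : (π ^ 2) i = i := by
        rw [pow_two, Perm.mul_apply, ← h1]
        simp
      rw [(π.isCycleOn_cycleFinset i).pow_apply_eq
        (Perm.mem_cycleFinset.2 (Perm.SameCycle.refl _ _)), Nat.dvd_prime Nat.prime_two] at h2
      rcases h2 with h2 | h2
      · rw [Finset.card_eq_one] at h2
        obtain ⟨a, ha⟩ := h2
        have e1 : i = a := by
          rw [← Finset.mem_singleton, ← ha, Perm.mem_cycleFinset]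
        have e2 : π i = a := by
          rw [← Finset.mem_singleton, ← ha, Perm.mem_cycleFinset]
          exact ⟨1, by simp⟩
        apply hne
        simp only [hf]
        rw [Finset.prod_eq_zero (Finset.mem_univ i), mul_zero]
        rw [e2, ← e1]
        exact hdiag i (hi.1 i (Perm.SameCycle.refl _ _))
      · have := hi.2
        rw [h2] at this
        exact absurd this (by decide)
    · intro π hπ
      rw [Finset.mem_filter] at hπ ⊢
      exact ⟨Finset.mem_univ _, by rw [Perm.oddCycles_reverseCycle]; exact hπ.2⟩
    · intro π hπ
      have h := (Finset.mem_filter.1 hπ).2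
      have h' : (Perm.oddCycles W (π.reverseCycle (c _ h))).Nonempty := by
        rw [Perm.oddCycles_reverseCycle]; exact h
      have : c _ h' = c _ h := hc _ _ _ _ (Perm.oddCycles_reverseCycle W π _)
      change (π.reverseCycle (c _ h)).reverseCycle (c _ h') = π
      rw [this, Perm.reverseCycle_reverseCycle]
  rw [hdet', ← Finset.sum_filter_add_sum_filter_not _
    (fun π : Perm n => (Perm.oddCycles W π).Nonempty), hsum, zero_add] at hdet
  obtain ⟨π, hπ, hne⟩ := Finset.exists_ne_zero_of_sum_ne_zero hdet
  refine ⟨π, fun i hi => hne ?_, Set.not_nonempty_iff_eq_empty.1 (Finset.mem_filter.1 hπ).2⟩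
  simp only [hf]
  rw [Finset.prod_eq_zero (Finset.mem_univ i) hi, mul_zero]

end Matrix

/-! ### Replacing even cycles by 2-cycles -/

namespace Equiv.Perm

variable {n : Type*} [Fintype n] [DecidableEq n]

/-- The points of even cycles can be two-coloured alternately. -/
theorem exists_alternating_coloring (π : Perm n) :
    ∃ c : n → Prop, ∀ i, Even (π.cycleFinset i).card → (c (π i) ↔ ¬ c i) := by
  let rep : n → n := fun i => (Quotient.mk (SameCycle.setoid π) i).out
  have hrep : ∀ i, π.SameCycle (rep i) i := fun i =>
    Quotient.exact (s := SameCycle.setoid π) (Quotient.out_eq _)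
  have hrep' : ∀ i, rep (π i) = rep i := by
    intro i
    change (Quotient.mk (SameCycle.setoid π) (π i)).out = (Quotient.mk (SameCycle.setoid π) i).out
    congr 1
    exact Quotient.sound (s := SameCycle.setoid π) (show π.SameCycle (π i) i from ⟨-1, by simp⟩)
  -- Colour by parity of the distance from a representative of the cycle; this is consistent when
  -- the cycle length is even.
  refine ⟨fun i => ∃ m : ℤ, Even m ∧ (π ^ m) (rep i) = i, fun i hi => ?_⟩
  simp only [hrep']
  constructor
  · rintro ⟨m, hm, hmi⟩ ⟨m', hm', hmi'⟩
    have h1 : (π ^ (m - m' - 1)) i = i := by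
      rw [← hmi', ← Perm.mul_apply, ← zpow_add]
      rw [show m - m' - 1 + m' = -1 + m by ring, zpow_add, Perm.mul_apply, hmi]
      simp [hmi']
    rw [(π.isCycleOn_cycleFinset i).zpow_apply_eq (mem_cycleFinset.2 (SameCycle.refl _ _))] at h1
    have h2 : Even (m - m' - 1) := by
      rw [even_iff_two_dvd]
      exact dvd_trans (by exact_mod_cast hi.two_dvd) h1
    exact absurd h2 (by rw [Int.not_even_iff_odd]; exact (hm.sub hm').sub_odd odd_one)
  · intro h
    obtain ⟨m, hm⟩ := hrep i
    have hodd : Odd m := by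
      rw [← Int.not_even_iff_odd]
      exact fun he => h ⟨m, he, hm⟩
    refine ⟨1 + m, odd_one.add_odd hodd, ?_⟩
    rw [zpow_add, Perm.mul_apply, hm, zpow_one]

end Equiv.Perm

namespace Matrix

open Equiv

variable {n R : Type*} [Fintype n] [DecidableEq n] [CommRing R]

/-- If a matrix that is alternating on `W` is non-singular, then it has a transversal of nonzero
entries all of whose cycles inside `W` have length two. -/
theorem exists_perm_of_alternating_on (A : Matrix n n R) (W : Set n)
    (hskew : ∀ i ∈ W, ∀ j ∈ W, A j i = - A i j) (hdiag : ∀ i ∈ W, A i i = 0) (hdet : A.det ≠ 0) :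
    ∃ (π : Perm n) (d : n → ℕ), (∀ i, A i (π i) ≠ 0) ∧
      ∀ i ∈ W, π i ∈ W → π (π i) = i ∨ d i < d (π i) := by
  classical
  obtain ⟨π, hne, hodd⟩ := exists_perm_oddCycles_eq_empty A W hskew hdiag hdet
  obtain ⟨c, hc⟩ := π.exists_alternating_coloring
  let closed : n → Prop := fun i => ∀ j, π.SameCycle i j → j ∈ W
  have hcl : ∀ {i j}, π.SameCycle i j → closed i → closed j := fun hij hi k hk => hi k (hij.trans hk)
  have happ : ∀ i, π (π⁻¹ i) = i := fun i => by simp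
  have hinvapp : ∀ i, π⁻¹ (π i) = i := fun i => by simp
  have hs1 : ∀ i, π.SameCycle i (π i) := fun i => ⟨1, by simp⟩
  have hs2 : ∀ i, π.SameCycle i (π⁻¹ i) := fun i => ⟨-1, by simp⟩
  have heven : ∀ i, closed i → (c (π i) ↔ ¬ c i) := by
    intro i hi
    apply hc
    rw [← Nat.not_odd_iff_even]
    intro h
    have : i ∈ Perm.oddCycles W π := ⟨hi, h⟩
    rw [hodd] at this
    exact this
  -- On a cycle inside `W`, which is even by `heven`, keep every other arc and use it in both
  -- directions; leave all other cycles alone.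
  let g : n → n := fun i => if closed i then (if c i then π i else π⁻¹ i) else π i
  have hgs : ∀ i, π.SameCycle i (g i) := by
    intro i
    simp only [g]
    split_ifs
    exacts [hs1 i, hs2 i, hs1 i]
  have hgg : ∀ i, closed i → g (g i) = i := by
    intro i hi
    have h1 := heven i hi
    have h2 := heven (π⁻¹ i) (hcl (hs2 i) hi)
    rw [happ] at h2
    by_cases hci : c i
    · have : g i = π i := by simp only [g, if_pos hi, if_pos hci]
      rw [this]
      simp only [g, if_pos (hcl (hs1 i) hi), if_neg (fun h => h1.1 h hci), hinvapp]
    · have : g i = π⁻¹ i := by simp only [g, if_pos hi, if_neg hci]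
      rw [this]
      have hcc : c (π⁻¹ i) := by
        by_contra h
        exact hci (h2.2 h)
      simp only [g, if_pos (hcl (hs2 i) hi), if_pos hcc, happ]
  have hinj : Function.Injective g := by
    intro i j hij
    by_cases hi : closed i
    · have hj : closed j := hcl ((hgs i).trans (hij ▸ (hgs j).symm)) hi
      rw [← hgg i hi, hij, hgg j hj]
    · have hj : ¬ closed j := fun h => hi (hcl ((hgs j).trans (hij ▸ (hgs i).symm)) h)
      simp only [g, if_neg hi, if_neg hj] at hij
      exact π.injective hij
  let π' : Perm n := Equiv.ofBijective g (Finite.injective_iff_bijective.1 hinj)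
  have hπ' : ∀ i, π' i = g i := fun _ => rfl
  -- The rank counts the backward steps along `π` needed to leave `W`. On cycles inside `W` the set
  -- is empty and the default value $0$ is never used.
  refine ⟨π', fun i => sInf {m | (π⁻¹ ^ m) i ∉ W}, ?_, ?_⟩
  · intro i
    rw [hπ']
    by_cases hi : closed i
    · by_cases hci : c i
      · simp only [g, if_pos hi, if_pos hci]
        exact hne i
      · simp only [g, if_pos hi, if_neg hci]
        have h1 := hne (π⁻¹ i)
        rw [happ] at h1
        rw [hskew _ (hi _ (hs2 i)) _ (hi _ (Perm.SameCycle.refl _ _))]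
        exact neg_ne_zero.2 h1
    · simp only [g, if_neg hi]
      exact hne i
  · intro i hi hπi
    simp only [hπ'] at hπi ⊢
    by_cases hcli : closed i
    · exact Or.inl (hgg i hcli)
    · right
      simp only [g, if_neg hcli] at hπi ⊢
      have hex : ∃ m : ℕ, (π⁻¹ ^ m) (π i) ∉ W := by
        by_contra! h
        apply hcli
        intro j hj
        obtain ⟨m, rfl⟩ := (Perm.sameCycle_inv.2 ((hs1 i).symm.trans hj)).exists_nat_pow_eq
        exact h m
      have h1 : sInf {m | (π⁻¹ ^ m) (π i) ∉ W} ∈ {m | (π⁻¹ ^ m) (π i) ∉ W} := Nat.sInf_mem hex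
      set D := sInf {m | (π⁻¹ ^ m) (π i) ∉ W}
      rcases D with _ | m
      · change (π⁻¹ ^ 0) (π i) ∉ W at h1
        rw [pow_zero] at h1
        exact absurd hπi h1
      · refine Nat.lt_succ_of_le (Nat.sInf_le ?_)
        have h2 : (π⁻¹ ^ (m + 1)) (π i) ∉ W := h1
        rw [pow_succ, Perm.mul_apply, hinvapp] at h2
        exact h2

end Matrix

/-! ### Walks and the paths of an edge set -/

namespace SimpleGraph.Walk

variable {V : Type*} {H : SimpleGraph V}

theorem IsPath.eq_getVert_of_mem_edges {a b w : V} {p : H.Walk a b} (hp : p.IsPath) {i : ℕ}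
    (hi : i ≤ p.length) (h : s(p.getVert i, w) ∈ p.edges) :
    (i < p.length ∧ w = p.getVert (i + 1)) ∨ ∃ j, i = j + 1 ∧ w = p.getVert j := by
  obtain ⟨j, hj, hjj⟩ := (p.mk_mem_edges_iff_exists).1 h
  rw [Sym2.eq_iff] at hjj
  rcases hjj with ⟨h1, h2⟩ | ⟨h1, h2⟩
  · obtain rfl := hp.getVert_injOn (show j ≤ p.length from hj.le) hi h1
    exact Or.inl ⟨hj, h2.symm⟩
  · have := hp.getVert_injOn (show j + 1 ≤ p.length from hj) hi h2
    exact Or.inr ⟨j, this.symm, h1.symm⟩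

theorem mk_getVert_mem_edges {a b : V} (p : H.Walk a b) {i : ℕ} (hi : i < p.length) :
    s(p.getVert i, p.getVert (i + 1)) ∈ p.edges :=
  (p.mk_mem_edges_iff_exists).2 ⟨i, hi, rfl⟩

theorem forall_mem_support_of_iff {a b : V} (p : H.Walk a b) (Q : V → Prop)
    (hQ : ∀ u w, s(u, w) ∈ p.edges → (Q u ↔ Q w)) {x : V} (hx : x ∈ p.support) (hQx : Q x) :
    ∀ y ∈ p.support, Q y := by
  have key : ∀ k, k ≤ p.length → (Q (p.getVert k) ↔ Q (p.getVert 0)) := by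
    intro k
    induction k with
    | zero => exact fun _ => Iff.rfl
    | succ k ih =>
      intro hk
      rw [← ih (Nat.le_of_succ_le hk)]
      exact (hQ _ _ (p.mk_getVert_mem_edges hk)).symm
  intro y hy
  obtain ⟨i, rfl, hi⟩ := mem_support_iff_exists_getVert.1 hx
  obtain ⟨j, rfl, hj⟩ := mem_support_iff_exists_getVert.1 hy
  exact (key j hj).2 ((key i hi).1 hQx)

end SimpleGraph.Walk

namespace BPMInstance

open SimpleGraph

variable {V : Type*} [Finite V] {G : BPMInstance V}

theorem not_mem_T₂_of_mem_T₁ {v : V} (h : v ∈ G.T₁) : v ∉ G.T₂ :=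
  fun h' => Set.disjoint_left.1 G.disjoint_T₁_T₂ h h'

theorem not_mem_S_of_mem_T₁ {v : V} (h : v ∈ G.T₁) : v ∉ G.S :=
  fun h' => Set.disjoint_left.1 G.disjoint_T₁_S h h'

theorem not_mem_S_of_mem_T₂ {v : V} (h : v ∈ G.T₂) : v ∉ G.S :=
  fun h' => Set.disjoint_left.1 G.disjoint_T₂_S h h'

theorem IsPathOf.reverse {M : Set (Sym2 V)} {a b : V} {p : G.graph.Walk a b}
    (h : G.IsPathOf M p) : G.IsPathOf M p.reverse := by
  obtain ⟨h1, h2, h3, h4⟩ := h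
  refine ⟨h1.reverse, ?_, ?_, ?_⟩
  · simpa using h2
  · simpa using h3
  · intro w hw
    rcases h4 w (by simpa using hw) with h | h | h <;> tauto

variable (G) in
/-- The ends of a path that is traversed from `T₁` towards `T₂`. -/
def IsOriented (a b : V) : Prop :=
  a ∈ G.T₁ ∧ b ∈ G.T₂ ∨ a ∈ G.T₁ ∧ b ∈ G.S ∨ a ∈ G.S ∧ b ∈ G.T₂

theorem IsOriented.not_mem_T₂ {a b : V} (h : G.IsOriented a b) : a ∉ G.T₂ := by
  intro ha
  rcases h with h | h | h
  · exact not_mem_T₂_of_mem_T₁ h.1 ha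
  · exact not_mem_T₂_of_mem_T₁ h.1 ha
  · exact not_mem_S_of_mem_T₂ ha h.1

theorem IsOriented.not_mem_T₁ {a b : V} (h : G.IsOriented a b) : b ∉ G.T₁ := by
  intro hb
  rcases h with h | h | h
  · exact not_mem_T₂_of_mem_T₁ hb h.2
  · exact not_mem_S_of_mem_T₁ hb h.2
  · exact not_mem_T₂_of_mem_T₁ hb h.2

/-- No edge of `M` outside `q` meets `q`, so each edge of `p` leaving a common vertex belongs to
`q`, and it cannot go back because `p` is a path. Only `q` has to be a full component of `M`; this
allows `p` to be a piece of it. -/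
theorem getVert_eq_of_start_eq {M : Set (Sym2 V)} {a b b' : V} {p : G.graph.Walk a b}
    {q : G.graph.Walk a b'} (hp : p.IsPath) (hpM : ∀ e ∈ p.edges, e ∈ M) (hq : G.IsPathOf M q)
    (k : ℕ) (hk : k ≤ p.length) : k ≤ q.length ∧ p.getVert k = q.getVert k := by
  induction k using Nat.strong_induction_on with
  | _ k ih =>
    rcases k with _ | k
    · simp
    · obtain ⟨h1, h2⟩ := ih k (Nat.lt_succ_self k) (Nat.le_of_succ_le hk)
      have h3 := hq.2.2.1 _ (hpM _ (p.mk_getVert_mem_edges hk)) (q.getVert k)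
        (q.getVert_mem_support k) (by rw [h2]; exact Sym2.mem_mk_left _ _)
      rw [h2] at h3
      rcases hq.1.eq_getVert_of_mem_edges h1 h3 with ⟨h4, h5⟩ | ⟨j, rfl, h5⟩
      · exact ⟨h4, h5⟩
      · rw [← (ih j (by omega) (by omega)).2] at h5
        have := hp.getVert_injOn (show j + 1 + 1 ≤ p.length from hk)
          (show j ≤ p.length by omega) h5
        omega

theorem mem_support_of_common {M : Set (Sym2 V)} {a b a' b' x : V} {p : G.graph.Walk a b}
    {q : G.graph.Walk a' b'} (hpM : ∀ e ∈ p.edges, e ∈ M) (hq : G.IsPathOf M q)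
    (hxp : x ∈ p.support) (hxq : x ∈ q.support) : ∀ y ∈ p.support, y ∈ q.support := by
  refine p.forall_mem_support_of_iff (· ∈ q.support) (fun u w h => ⟨fun hu => ?_, fun hw => ?_⟩)
    hxp hxq
  · exact q.snd_mem_support_of_mem_edges (hq.2.2.1 _ (hpM _ h) _ hu (Sym2.mem_mk_left _ _))
  · exact q.fst_mem_support_of_mem_edges (hq.2.2.1 _ (hpM _ h) _ hw (Sym2.mem_mk_right _ _))

/-- One end of `p` is a terminal on its proper side. Terminals are never internal to a path, so it
is also the corresponding end of `q`. Compare the paths from this end, reversing both if it lies in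
$T_2$. -/
theorem exists_shift_of_common {M : Set (Sym2 V)} {a b a' b' x : V} {p : G.graph.Walk a b}
    {q : G.graph.Walk a' b'} (hab : G.IsOriented a b) (hab' : G.IsOriented a' b')
    (hp : p.IsPath) (hpM : ∀ e ∈ p.edges, e ∈ M) (hq : G.IsPathOf M q)
    (hxp : x ∈ p.support) (hxq : x ∈ q.support) :
    ∃ c, c + p.length ≤ q.length ∧ ∀ k ≤ p.length, p.getVert k = q.getVert (k + c) := by
  have hsub := mem_support_of_common hpM hq hxp hxq
  have hends : a ∈ G.T₁ ∨ b ∈ G.T₂ := by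
    rcases hab with h | h | h <;> tauto
  rcases hends with ha | hb
  · have haa : a = a' := by
      rcases hq.2.2.2 a (hsub a p.start_mem_support) with h | h | h
      · exact h
      · exact absurd (h ▸ ha) hab'.not_mem_T₁
      · exact absurd h (not_mem_S_of_mem_T₁ ha)
    subst haa
    have := getVert_eq_of_start_eq hp hpM hq
    exact ⟨0, by simpa using (this _ le_rfl).1, fun k hk => (this k hk).2⟩
  · have hbb : b = b' := by
      rcases hq.2.2.2 b (hsub b p.end_mem_support) with h | h | h
      · exact absurd (h ▸ hb) hab'.not_mem_T₂
      · exact h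
      · exact absurd h (not_mem_S_of_mem_T₂ hb)
    subst hbb
    have := getVert_eq_of_start_eq (M := M) hp.reverse (by simpa using hpM) hq.reverse
    simp only [Walk.length_reverse, Walk.getVert_reverse] at this
    have hl := (this _ le_rfl).1
    refine ⟨q.length - p.length, by omega, fun k hk => ?_⟩
    have h1 := (this (p.length - k) (Nat.sub_le _ _)).2
    rw [show p.length - (p.length - k) = k by omega,
      show q.length - (p.length - k) = k + (q.length - p.length) by omega] at h1
    exact h1

theorem IsPathOf.eq_of_common {M : Set (Sym2 V)} {a b a' b' : V} {p : G.graph.Walk a b}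
    {q : G.graph.Walk a' b'} (hab : G.IsOriented a b) (hab' : G.IsOriented a' b')
    (hp : G.IsPathOf M p) (hq : G.IsPathOf M q) {i j : ℕ} (hi : i ≤ p.length) (hj : j ≤ q.length)
    (hij : p.getVert i = q.getVert j) :
    i = j ∧ p.length = q.length ∧ ∀ k ≤ p.length, p.getVert k = q.getVert k := by
  have h1 := p.getVert_mem_support i
  have h2 := q.getVert_mem_support j
  obtain ⟨c, hc, hc'⟩ := exists_shift_of_common hab hab' hp.1 hp.2.1 hq h1 (hij ▸ h2)
  obtain ⟨c', hc2, -⟩ := exists_shift_of_common hab' hab hq.1 hq.2.1 hp h2 (hij ▸ h1)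
  obtain rfl : c = 0 := by omega
  have hl : p.length = q.length := by omega
  refine ⟨?_, hl, hc'⟩
  rw [hc' i hi] at hij
  exact hq.1.getVert_injOn (show i ≤ q.length by omega) hj hij

/-- By connectedness the whole path would lie in the matching edge, hence in $S$, but an oriented
path has an end in $T_1\cup T_2$. -/
theorem not_mem_support_of_mem_matchingPart {M : Set (Sym2 V)} {a b x : V} {p : G.graph.Walk a b}
    (hab : G.IsOriented a b) (hpM : ∀ e ∈ p.edges, e ∈ M) {e : Sym2 V}
    (he : e ∈ G.matchingPart M) (hx : x ∈ e) : x ∉ p.support := by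
  intro hxp
  have := p.forall_mem_support_of_iff (· ∈ e) (fun u w h => ⟨fun hu => ?_, fun hw => ?_⟩) hxp hx
  · have ha := he.2.1 a (this a p.start_mem_support)
    have hb := he.2.1 b (this b p.end_mem_support)
    rcases hab with h | h | h
    · exact not_mem_S_of_mem_T₁ h.1 ha
    · exact not_mem_S_of_mem_T₁ h.1 ha
    · exact not_mem_S_of_mem_T₂ h.2 hb
  · rw [← he.2.2 _ (hpM _ h) u hu (Sym2.mem_mk_left _ _)]
    exact Sym2.mem_mk_right _ _
  · rw [← he.2.2 _ (hpM _ h) w hw (Sym2.mem_mk_right _ _)]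
    exact Sym2.mem_mk_left _ _

/-! ### The successor relation of a partial path-matching -/

variable (G) in
/-- `w` follows `u` on a path of `M` traversed from `T₁` towards `T₂`, or `u` and `w` are the two
ends of a matching edge. -/
def Succ (M : Set (Sym2 V)) (u w : V) : Prop :=
  s(u, w) ∈ G.matchingPart M ∨ ∃ (a b : V) (p : G.graph.Walk a b), G.IsOriented a b ∧
    G.IsPathOf M p ∧ ∃ i < p.length, p.getVert i = u ∧ p.getVert (i + 1) = w

theorem Succ.mem {M : Set (Sym2 V)} {u w : V} (h : G.Succ M u w) : s(u, w) ∈ M := by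
  rcases h with h | ⟨a, b, p, -, hp, i, hi, rfl, rfl⟩
  · exact h.1
  · exact hp.2.1 _ (p.mk_getVert_mem_edges hi)

theorem IsPartialPathMatching.mem_cases {M : Set (Sym2 V)} (hM : G.IsPartialPathMatching M)
    {e : Sym2 V} (he : e ∈ M) : e ∈ G.matchingPart M ∨
      ∃ (a b : V) (p : G.graph.Walk a b), G.IsOriented a b ∧ G.IsPathOf M p ∧ e ∈ p.edges := by
  rcases hM.2 e he with h | ⟨u, v, p, huv, hp, hep⟩
  · exact Or.inl h
  · right
    rcases huv with h | h | h
    · exact ⟨u, v, p, Or.inl h, hp, hep⟩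
    · exact ⟨u, v, p, Or.inr (Or.inl h), hp, hep⟩
    · exact ⟨v, u, p.reverse, Or.inr (Or.inr h.symm), hp.reverse, by simpa using hep⟩

theorem IsPartialPathMatching.succ_or_succ {M : Set (Sym2 V)} (hM : G.IsPartialPathMatching M)
    {u w : V} (h : s(u, w) ∈ M) : G.Succ M u w ∨ G.Succ M w u := by
  rcases hM.mem_cases h with h | ⟨a, b, p, hab, hp, hep⟩
  · exact Or.inl (Or.inl h)
  · obtain ⟨i, hi, h⟩ := (p.mk_mem_edges_iff_exists).1 hep
    rw [Sym2.eq_iff] at h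
    rcases h with ⟨h1, h2⟩ | ⟨h1, h2⟩
    · exact Or.inl (Or.inr ⟨a, b, p, hab, hp, i, hi, h1, h2⟩)
    · exact Or.inr (Or.inr ⟨a, b, p, hab, hp, i, hi, h1, h2⟩)

theorem Succ.right_unique {M : Set (Sym2 V)} {u w w' : V} (h : G.Succ M u w)
    (h' : G.Succ M u w') : w = w' := by
  rcases h with h | ⟨a, b, p, hab, hp, i, hi, hu, hw⟩
  · rcases h' with h' | ⟨a', b', q, hab', hq, j, hj, hu', hw'⟩
    · have := h.2.2 _ h'.1 u (Sym2.mem_mk_left _ _) (Sym2.mem_mk_left _ _)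
      exact (Sym2.congr_right.1 this).symm
    · exact absurd (hu' ▸ q.getVert_mem_support j)
        (not_mem_support_of_mem_matchingPart hab' hq.2.1 h (Sym2.mem_mk_left _ _))
  · rcases h' with h' | ⟨a', b', q, hab', hq, j, hj, hu', hw'⟩
    · exact absurd (hu ▸ p.getVert_mem_support i)
        (not_mem_support_of_mem_matchingPart hab hp.2.1 h' (Sym2.mem_mk_left _ _))
    · obtain ⟨rfl, -, h⟩ := hp.eq_of_common hab hab' hq hi.le hj.le (hu.trans hu'.symm)
      rw [← hw, ← hw', h _ hi]

theorem Succ.left_unique {M : Set (Sym2 V)} {u u' w : V} (h : G.Succ M u w)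
    (h' : G.Succ M u' w) : u = u' := by
  rcases h with h | ⟨a, b, p, hab, hp, i, hi, hu, hw⟩
  · rcases h' with h' | ⟨a', b', q, hab', hq, j, hj, hu', hw'⟩
    · have := h.2.2 _ h'.1 w (Sym2.mem_mk_right _ _) (Sym2.mem_mk_right _ _)
      exact (Sym2.congr_left.1 this).symm
    · exact absurd (hw' ▸ q.getVert_mem_support _)
        (not_mem_support_of_mem_matchingPart hab' hq.2.1 h (Sym2.mem_mk_right _ _))
  · rcases h' with h' | ⟨a', b', q, hab', hq, j, hj, hu', hw'⟩
    · exact absurd (hw ▸ p.getVert_mem_support _)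
        (not_mem_support_of_mem_matchingPart hab hp.2.1 h' (Sym2.mem_mk_right _ _))
    · obtain ⟨hij, -, h⟩ := hp.eq_of_common hab hab' hq (Nat.succ_le_of_lt hi)
        (Nat.succ_le_of_lt hj) (hw.trans hw'.symm)
      obtain rfl : i = j := by omega
      rw [← hu, ← hu', h _ hi.le]

theorem C₁_subset_bdS {M : Set (Sym2 V)} : G.C₁ M ⊆ G.bdS M := by
  rintro c ⟨hc, u, hu, p, hp⟩
  refine ⟨hc, ?_⟩
  have hl : 0 < p.length := by
    rw [Nat.pos_iff_ne_zero]
    intro h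
    exact not_mem_S_of_mem_T₁ hu (Walk.eq_of_length_eq_zero h ▸ hc)
  refine ⟨_, hp.2.1 _ (p.mk_getVert_mem_edges (i := p.length - 1) (by omega)), ?_⟩
  rw [Nat.sub_add_cancel hl, p.getVert_length]
  exact Sym2.mem_mk_right _ _

theorem C₂_subset_bdS {M : Set (Sym2 V)} : G.C₂ M ⊆ G.bdS M := by
  rintro c ⟨hc, u, hu, p, hp⟩
  refine ⟨hc, ?_⟩
  have hl : 0 < p.length := by
    rw [Nat.pos_iff_ne_zero]
    intro h
    exact not_mem_S_of_mem_T₂ hu (Walk.eq_of_length_eq_zero h ▸ hc)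
  refine ⟨_, hp.2.1 _ (p.mk_getVert_mem_edges (i := p.length - 1) (by omega)), ?_⟩
  rw [Nat.sub_add_cancel hl, p.getVert_length]
  exact Sym2.mem_mk_right _ _

theorem mem_C₁_iff {M : Set (Sym2 V)} {c : V} : c ∈ G.C₁ M ↔
    c ∈ G.S ∧ ∃ (a : V) (p : G.graph.Walk a c), G.IsOriented a c ∧ G.IsPathOf M p := by
  constructor
  · rintro ⟨hc, u, hu, p, hp⟩
    exact ⟨hc, u, p, Or.inr (Or.inl ⟨hu, hc⟩), hp⟩
  · rintro ⟨hc, u, p, h, hp⟩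
    refine ⟨hc, u, ?_, p, hp⟩
    rcases h with h | h | h
    · exact h.1
    · exact h.1
    · exact absurd hc (not_mem_S_of_mem_T₂ h.2)

theorem mem_C₂_iff {M : Set (Sym2 V)} {c : V} : c ∈ G.C₂ M ↔
    c ∈ G.S ∧ ∃ (b : V) (p : G.graph.Walk c b), G.IsOriented c b ∧ G.IsPathOf M p := by
  constructor
  · rintro ⟨hc, u, hu, p, hp⟩
    exact ⟨hc, u, p.reverse, Or.inr (Or.inr ⟨hc, hu⟩), hp.reverse⟩
  · rintro ⟨hc, u, p, h, hp⟩
    refine ⟨hc, u, ?_, p.reverse, hp.reverse⟩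
    rcases h with h | h | h
    · exact h.2
    · exact absurd hc (not_mem_S_of_mem_T₁ h.1)
    · exact h.2

/-- The covered vertices without a successor are the last vertices of oriented paths, which lie in
$T_2$ or in $C_1$. The primed version below is the mirror image, for first vertices. -/
theorem IsPartialPathMatching.exists_succ_iff {M : Set (Sym2 V)} (hM : G.IsPartialPathMatching M)
    {u : V} : (∃ w, G.Succ M u w) ↔ u ∈ G.bd₁ M ∪ (G.bdS M \ G.C₁ M) := by
  constructor
  · rintro ⟨w, h⟩
    have hcov : ∃ e ∈ M, u ∈ e := ⟨_, h.mem, Sym2.mem_mk_left _ _⟩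
    rcases h with h | ⟨a, b, p, hab, hp, i, hi, rfl, rfl⟩
    · have hS := h.2.1 u (Sym2.mem_mk_left _ _)
      refine Or.inr ⟨⟨hS, hcov⟩, fun hC => ?_⟩
      obtain ⟨-, a, p, hau, hp⟩ := mem_C₁_iff.1 hC
      exact not_mem_support_of_mem_matchingPart hau hp.2.1 h (Sym2.mem_mk_left _ _)
        p.end_mem_support
    · by_cases hT : p.getVert i ∈ G.T₁
      · exact Or.inl ⟨hT, hcov⟩
      · have hS : p.getVert i ∈ G.S := by
          rcases hp.2.2.2 _ (p.getVert_mem_support i) with h | h | h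
          · rw [h] at hT ⊢
            rcases hab with h | h | h <;> tauto
          · replace h := h.trans p.getVert_length.symm
            have := hp.1.getVert_injOn (show i ≤ p.length from hi.le) (le_refl p.length) h
            omega
          · exact h
        refine Or.inr ⟨⟨hS, hcov⟩, fun hC => ?_⟩
        obtain ⟨-, a', q, hau, hq⟩ := mem_C₁_iff.1 hC
        obtain ⟨h1, h2, -⟩ := hp.eq_of_common hab hau hq hi.le (le_refl q.length)
          q.getVert_length.symm
        omega
  · rintro (⟨hT, e, he, hue⟩ | ⟨⟨hS, e, he, hue⟩, hC⟩)
    · rcases hM.mem_cases he with h | ⟨a, b, p, hab, hp, hep⟩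
      · exact absurd (h.2.1 u hue) (not_mem_S_of_mem_T₁ hT)
      · obtain ⟨i, rfl, hi⟩ := Walk.mem_support_iff_exists_getVert.1
          (p.mem_support_of_mem_edges hep hue)
        rcases hi.lt_or_eq with hi | rfl
        · exact ⟨_, Or.inr ⟨a, b, p, hab, hp, i, hi, rfl, rfl⟩⟩
        · rw [p.getVert_length] at hT
          exact absurd hT hab.not_mem_T₁
    · rcases hM.mem_cases he with h | ⟨a, b, p, hab, hp, hep⟩
      · obtain ⟨w, rfl⟩ := hue
        exact ⟨w, Or.inl h⟩
      · obtain ⟨i, rfl, hi⟩ := Walk.mem_support_iff_exists_getVert.1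
          (p.mem_support_of_mem_edges hep hue)
        rcases hi.lt_or_eq with hi | rfl
        · exact ⟨_, Or.inr ⟨a, b, p, hab, hp, i, hi, rfl, rfl⟩⟩
        · rw [p.getVert_length] at hS hC
          exact absurd (mem_C₁_iff.2 ⟨hS, a, p, hab, hp⟩) hC

theorem IsPartialPathMatching.exists_succ_iff' {M : Set (Sym2 V)} (hM : G.IsPartialPathMatching M)
    {w : V} : (∃ u, G.Succ M u w) ↔ w ∈ G.bd₂ M ∪ (G.bdS M \ G.C₂ M) := by
  constructor
  · rintro ⟨u, h⟩
    have hcov : ∃ e ∈ M, w ∈ e := ⟨_, h.mem, Sym2.mem_mk_right _ _⟩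
    rcases h with h | ⟨a, b, p, hab, hp, i, hi, rfl, rfl⟩
    · have hS := h.2.1 w (Sym2.mem_mk_right _ _)
      refine Or.inr ⟨⟨hS, hcov⟩, fun hC => ?_⟩
      obtain ⟨-, b, p, hau, hp⟩ := mem_C₂_iff.1 hC
      exact not_mem_support_of_mem_matchingPart hau hp.2.1 h (Sym2.mem_mk_right _ _)
        p.start_mem_support
    · by_cases hT : p.getVert (i + 1) ∈ G.T₂
      · exact Or.inl ⟨hT, hcov⟩
      · have hS : p.getVert (i + 1) ∈ G.S := by
          rcases hp.2.2.2 _ (p.getVert_mem_support (i + 1)) with h | h | h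
          · replace h := h.trans p.getVert_zero.symm
            have := hp.1.getVert_injOn (show i + 1 ≤ p.length from hi) (Nat.zero_le p.length) h
            omega
          · rw [h] at hT ⊢
            rcases hab with h | h | h <;> tauto
          · exact h
        refine Or.inr ⟨⟨hS, hcov⟩, fun hC => ?_⟩
        obtain ⟨-, b', q, hau, hq⟩ := mem_C₂_iff.1 hC
        obtain ⟨h1, h2, -⟩ := hp.eq_of_common hab hau hq (Nat.succ_le_of_lt hi)
          (Nat.zero_le q.length) q.getVert_zero.symm
        omega
  · rintro (⟨hT, e, he, hue⟩ | ⟨⟨hS, e, he, hue⟩, hC⟩)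
    · rcases hM.mem_cases he with h | ⟨a, b, p, hab, hp, hep⟩
      · exact absurd (h.2.1 w hue) (not_mem_S_of_mem_T₂ hT)
      · obtain ⟨i, rfl, hi⟩ := Walk.mem_support_iff_exists_getVert.1
          (p.mem_support_of_mem_edges hep hue)
        rcases i with _ | i
        · rw [p.getVert_zero] at hT
          exact absurd hT hab.not_mem_T₂
        · exact ⟨_, Or.inr ⟨a, b, p, hab, hp, i, hi, rfl, rfl⟩⟩
    · rcases hM.mem_cases he with h | ⟨a, b, p, hab, hp, hep⟩
      · obtain ⟨u, rfl⟩ := hue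
        exact ⟨u, Or.inl (Sym2.eq_swap ▸ h)⟩
      · obtain ⟨i, rfl, hi⟩ := Walk.mem_support_iff_exists_getVert.1
          (p.mem_support_of_mem_edges hep hue)
        rcases i with _ | i
        · rw [p.getVert_zero] at hS hC
          exact absurd (mem_C₂_iff.2 ⟨hS, b, p, hab, hp⟩) hC
        · exact ⟨_, Or.inr ⟨a, b, p, hab, hp, i, hi, rfl, rfl⟩⟩

/-- A path of `M` keeps its terminal end, so inside a larger path of `M'` it keeps its orientation.
Matching edges have no such anchor: they need `hmat`, since otherwise they could become one-way path
edges. -/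
theorem Succ.mono {M M' : Set (Sym2 V)} (hM' : G.IsPartialPathMatching M') (hsub : M ⊆ M')
    (hmat : G.matchingPart M ⊆ G.matchingPart M') {u w : V} (h : G.Succ M u w) :
    G.Succ M' u w := by
  have hmem := hsub h.mem
  rcases h with h | ⟨a, b, p, hab, hp, i, hi, rfl, rfl⟩
  · exact Or.inl (hmat h)
  · have hpM' : ∀ e ∈ p.edges, e ∈ M' := fun e he => hsub (hp.2.1 e he)
    rcases hM'.mem_cases hmem with h | ⟨a', b', q, hab', hq, hqe⟩
    · exact absurd (p.getVert_mem_support i)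
        (not_mem_support_of_mem_matchingPart hab hpM' h (Sym2.mem_mk_left _ _))
    · obtain ⟨c, hc, hcc⟩ := exists_shift_of_common hab hab' hp.1 hpM' hq
        (p.getVert_mem_support i) (q.fst_mem_support_of_mem_edges hqe)
      refine Or.inr ⟨a', b', q, hab', hq, i + c, by omega, (hcc i hi.le).symm, ?_⟩
      rw [hcc (i + 1) hi]
      congr 1
      omega

variable (G) in
/-- `x` is the vertex number `n.2` of a path of `M`, traversed from `T₁` towards `T₂`; the number
`n.1` is `0` or `2` according as this path starts in `T₁` or not. -/
def HasPosition (M : Set (Sym2 V)) (x : V) (n : ℕ ×ₗ ℕ) : Prop :=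
  ∃ (a b : V) (p : G.graph.Walk a b), G.IsOriented a b ∧ G.IsPathOf M p ∧
    (ofLex n).2 ≤ p.length ∧ p.getVert (ofLex n).2 = x ∧
    (a ∈ G.T₁ ∧ (ofLex n).1 = 0 ∨ a ∉ G.T₁ ∧ (ofLex n).1 = 2)

theorem HasPosition.unique {M : Set (Sym2 V)} {x : V} {n n' : ℕ ×ₗ ℕ} (h : G.HasPosition M x n)
    (h' : G.HasPosition M x n') : n = n' := by
  obtain ⟨a, b, p, hab, hp, hi, hx, hz⟩ := h
  obtain ⟨a', b', q, hab', hq, hj, hx', hz'⟩ := h'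
  obtain ⟨h1, -, h2⟩ := hp.eq_of_common hab hab' hq hi hj (hx.trans hx'.symm)
  have h3 := h2 0 (Nat.zero_le _)
  rw [p.getVert_zero, q.getVert_zero] at h3
  subst h3
  apply ofLex.injective
  refine Prod.ext ?_ h1
  rcases hz with hz | hz <;> rcases hz' with hz' | hz'
  · rw [hz.2, hz'.2]
  · exact absurd hz.1 hz'.1
  · exact absurd hz'.1 hz.1
  · rw [hz.2, hz'.2]

-- The rank is lexicographic: first a level for the path, then the position on it. Paths starting in
-- $T_1$ have level 0 and those starting in $S$ have level 2, leaving level 1 for vertices of $S$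
-- not yet covered. Vertices on no path get the default value 0.
variable (G) in
theorem exists_rank (M : Set (Sym2 V)) : ∃ d : V → ℕ ×ₗ ℕ,
    (∀ u w, G.Succ M u w → G.Succ M w u ∨ d u < d w) ∧
    (∀ c ∈ G.C₁ M, (ofLex (d c)).1 = 0) ∧ ∀ c ∈ G.C₂ M, (ofLex (d c)).1 = 2 := by
  classical
  let d : V → ℕ ×ₗ ℕ := fun x => if h : ∃ n, G.HasPosition M x n then h.choose else 0
  have hd : ∀ x n, G.HasPosition M x n → d x = n := by
    intro x n h
    have hex : ∃ n, G.HasPosition M x n := ⟨n, h⟩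
    simp only [d, dif_pos hex]
    exact hex.choose_spec.unique h
  refine ⟨d, ?_, ?_, ?_⟩
  · rintro u w (h | ⟨a, b, p, hab, hp, i, hi, rfl, rfl⟩)
    · exact Or.inl (Or.inl (Sym2.eq_swap ▸ h))
    · right
      by_cases ha : a ∈ G.T₁
      · rw [hd (p.getVert i) (toLex (0, i)) ⟨a, b, p, hab, hp, hi.le, rfl, Or.inl ⟨ha, rfl⟩⟩,
          hd (p.getVert (i + 1)) (toLex (0, i + 1)) ⟨a, b, p, hab, hp, hi, rfl, Or.inl ⟨ha, rfl⟩⟩,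
          Prod.Lex.toLex_lt_toLex]
        simp
      · rw [hd (p.getVert i) (toLex (2, i)) ⟨a, b, p, hab, hp, hi.le, rfl, Or.inr ⟨ha, rfl⟩⟩,
          hd (p.getVert (i + 1)) (toLex (2, i + 1)) ⟨a, b, p, hab, hp, hi, rfl, Or.inr ⟨ha, rfl⟩⟩,
          Prod.Lex.toLex_lt_toLex]
        simp
  · rintro c ⟨hc, u, hu, p, hp⟩
    rw [hd c (toLex (0, p.length)) ⟨u, c, p, Or.inr (Or.inl ⟨hu, hc⟩), hp, le_rfl,
      p.getVert_length, Or.inl ⟨hu, rfl⟩⟩]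
    rfl
  · rintro c ⟨hc, u, hu, p, hp⟩
    rw [hd c (toLex (2, 0)) ⟨c, u, p.reverse, Or.inr (Or.inr ⟨hc, hu⟩), hp.reverse, Nat.zero_le _,
      p.reverse.getVert_zero, Or.inr ⟨fun h => not_mem_S_of_mem_T₁ h hc, rfl⟩⟩]
    rfl

variable (G) in
/-- `R` is the graph of a bijection from `P` to `Q` along edges of `G` all of whose cycles have
length two, as is witnessed by the function `d`. -/
structure IsSuccessor (R : V → V → Prop) (P Q : Set V) (d : V → ℕ ×ₗ ℕ) : Prop where
  adj : ∀ {u w}, R u w → G.graph.Adj u w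
  right_unique : ∀ {u w w'}, R u w → R u w' → w = w'
  left_unique : ∀ {u u' w}, R u w → R u' w → u = u'
  dom : ∀ u, (∃ w, R u w) ↔ u ∈ P
  ran : ∀ w, (∃ u, R u w) ↔ w ∈ Q
  rank : ∀ {u w}, R u w → R w u ∨ d u < d w

theorem IsPartialPathMatching.isSuccessor {M : Set (Sym2 V)} (hM : G.IsPartialPathMatching M)
    {d : V → ℕ ×ₗ ℕ} (hd : ∀ u w, G.Succ M u w → G.Succ M w u ∨ d u < d w) :
    G.IsSuccessor (G.Succ M) (G.bd₁ M ∪ (G.bdS M \ G.C₁ M)) (G.bd₂ M ∪ (G.bdS M \ G.C₂ M)) d where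
  adj h := hM.1 h.mem
  right_unique h h' := h.right_unique h'
  left_unique h h' := h.left_unique h'
  dom _ := hM.exists_succ_iff
  ran _ := hM.exists_succ_iff'
  rank h := hd _ _ h

end BPMInstance

/-! ### From a successor relation back to a path-matching -/

namespace BPMInstance

open SimpleGraph

variable {V : Type*} [Finite V] {G : BPMInstance V}

omit [Finite V] in
theorem wellFounded_rank (d : V → ℕ ×ₗ ℕ) : WellFounded fun x y : V => d x < d y :=
  InvImage.wf d wellFounded_lt

theorem wellFounded_rank_gt (d : V → ℕ ×ₗ ℕ) : WellFounded fun x y : V => d y < d x := by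
  have : IsTrans V fun x y : V => d y < d x := ⟨fun _ _ _ h h' => h'.trans h⟩
  have : Std.Irrefl fun x y : V => d y < d x := ⟨fun _ h => lt_irrefl _ h⟩
  exact Finite.wellFounded_of_trans_of_irrefl _

namespace IsSuccessor

variable {R : V → V → Prop} {A B : Set V} {d : V → ℕ ×ₗ ℕ}

/-- One-way arcs raise `d`, and the arc after a one-way arc is again one-way by uniqueness of
predecessors. The walk can stop only at a vertex outside $S$, since every vertex of $S$ has a
successor. -/
theorem exists_walk_to_T₂ (h : G.IsSuccessor R (A ∪ G.S) (B ∪ G.S) d) (hB : B ⊆ G.T₂) :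
    ∀ u w, R u w → ¬ R w u → ∃ v ∈ G.T₂, ∃ p : G.graph.Walk u v, 0 < p.length ∧
      ∀ i < p.length, R (p.getVert i) (p.getVert (i + 1)) ∧
        d (p.getVert i) < d (p.getVert (i + 1)) := by
  intro u
  induction u using (wellFounded_rank_gt d).induction with
  | _ u ih =>
    intro w huw hwu
    have hlt : d u < d w := (h.rank huw).resolve_left hwu
    rcases (h.ran w).1 ⟨u, huw⟩ with hw | hw
    · refine ⟨w, hB hw, Walk.cons (h.adj huw) Walk.nil, by simp, ?_⟩
      intro i hi
      obtain rfl : i = 0 := by simpa using hi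
      exact ⟨huw, hlt⟩
    · obtain ⟨x, hwx⟩ := (h.dom w).2 (Or.inr hw)
      have hxw : ¬ R x w := fun hxw => hwu (by rwa [h.left_unique huw hxw])
      obtain ⟨v, hv, p, -, hp⟩ := ih w hlt x hwx hxw
      refine ⟨v, hv, Walk.cons (h.adj huw) p, by simp, ?_⟩
      intro i hi
      rcases i with _ | i
      · simpa using ⟨huw, hlt⟩
      · simpa using hp i (by simpa using hi)

/-- Descending induction on `d` through predecessors reaches $T_1$; from there the forward walk
passes through the given arc by uniqueness of successors. -/
theorem exists_walk_from_T₁ (h : G.IsSuccessor R (A ∪ G.S) (B ∪ G.S) d) (hA : A ⊆ G.T₁)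
    (hB : B ⊆ G.T₂) : ∀ u w, R u w → ¬ R w u → ∃ a ∈ G.T₁, ∃ v ∈ G.T₂, ∃ p : G.graph.Walk a v,
      (∀ i < p.length, R (p.getVert i) (p.getVert (i + 1)) ∧
        d (p.getVert i) < d (p.getVert (i + 1))) ∧ s(u, w) ∈ p.edges := by
  intro u
  induction u using (wellFounded_rank d).induction with
  | _ u ih =>
    intro w huw hwu
    rcases (h.dom u).1 ⟨w, huw⟩ with hu | hu
    · obtain ⟨v, hv, p, hl, hp⟩ := h.exists_walk_to_T₂ hB u w huw hwu
      refine ⟨u, hA hu, v, hv, p, hp, ?_⟩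
      have h1 := (hp 0 hl).1
      rw [p.getVert_zero] at h1
      have h2 := p.mk_getVert_mem_edges hl
      rwa [p.getVert_zero, h.right_unique h1 huw] at h2
    · obtain ⟨x, hxu⟩ := (h.ran u).2 (Or.inr hu)
      have hux : ¬ R u x := fun hux => hwu (by rwa [h.right_unique huw hux])
      obtain ⟨a, ha, v, hv, p, hp, hep⟩ := ih x ((h.rank hxu).resolve_left hux) u hxu hux
      refine ⟨a, ha, v, hv, p, hp, ?_⟩
      obtain ⟨i, hui, hi⟩ := Walk.mem_support_iff_exists_getVert.1
        (p.snd_mem_support_of_mem_edges hep)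
      have hi' : i < p.length := by
        refine lt_of_le_of_ne hi fun hil => ?_
        rw [hil, p.getVert_length] at hui
        rw [← hui] at hu
        exact not_mem_S_of_mem_T₂ hv hu
      have h1 := (hp i hi').1
      have h2 := p.mk_getVert_mem_edges hi'
      rw [hui] at h1 h2
      rwa [h.right_unique h1 huw] at h2

/-- Vertices do not repeat because `d` increases; no other edge meets the walk because successors
and predecessors are unique and the two ends have no further arc. -/
theorem isPathOf (h : G.IsSuccessor R (A ∪ G.S) (B ∪ G.S) d) (hA : A ⊆ G.T₁) (hB : B ⊆ G.T₂)
    {a v : V} (ha : a ∈ G.T₁) (hv : v ∈ G.T₂) {p : G.graph.Walk a v}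
    (hp : ∀ i < p.length, R (p.getVert i) (p.getVert (i + 1)) ∧
        d (p.getVert i) < d (p.getVert (i + 1))) :
    G.IsPathOf {e | ∃ u w, R u w ∧ e = s(u, w)} p := by
  have hmono : ∀ i j, i < j → j ≤ p.length → d (p.getVert i) < d (p.getVert j) := by
    intro i j hij
    induction j, hij using Nat.le_induction with
    | base => exact fun hj => (hp i hj).2
    | succ j _ ih => exact fun hj => (ih (by omega)).trans (hp j hj).2
  have hpath : p.IsPath := by
    rw [← Walk.IsPath.getVert_injOn_iff]
    intro i hi j hj hij
    rcases lt_trichotomy i j with hlt | heq | hlt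
    · exact absurd (hmono i j hlt hj) (by rw [hij]; exact lt_irrefl _)
    · exact heq
    · exact absurd (hmono j i hlt hi) (by rw [hij]; exact lt_irrefl _)
  refine ⟨hpath, ?_, ?_, ?_⟩
  · intro e he
    induction e with
    | _ x y =>
      obtain ⟨i, hi, h2⟩ := (p.mk_mem_edges_iff_exists).1 he
      exact ⟨_, _, (hp i hi).1, h2.symm⟩
  · rintro _ ⟨x, y, hxy, rfl⟩ w hw hwe
    obtain ⟨i, rfl, hi⟩ := Walk.mem_support_iff_exists_getVert.1 hw
    rcases Sym2.mem_iff.1 hwe with rfl | rfl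
    · have hi' : i < p.length := by
        refine lt_of_le_of_ne hi fun hil => ?_
        rw [hil, p.getVert_length] at hxy
        rcases (h.dom v).1 ⟨y, hxy⟩ with h1 | h1
        · exact not_mem_T₂_of_mem_T₁ (hA h1) hv
        · exact not_mem_S_of_mem_T₂ hv h1
      rw [h.right_unique hxy (hp i hi').1]
      exact p.mk_getVert_mem_edges hi'
    · rcases i with _ | i
      · rw [p.getVert_zero] at hxy
        rcases (h.ran a).1 ⟨x, hxy⟩ with h1 | h1
        · exact absurd (hB h1) (not_mem_T₂_of_mem_T₁ ha)
        · exact absurd h1 (not_mem_S_of_mem_T₁ ha)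
      · rw [h.left_unique hxy (hp i hi).1]
        exact p.mk_getVert_mem_edges hi
  · intro w hw
    obtain ⟨i, rfl, hi⟩ := Walk.mem_support_iff_exists_getVert.1 hw
    rcases i with _ | i
    · exact Or.inl p.getVert_zero
    · rcases hi.lt_or_eq with hi | hi
      · right; right
        rcases (h.dom _).1 ⟨_, (hp _ hi).1⟩ with h1 | h1
        · rcases (h.ran _).1 ⟨_, (hp i (by omega)).1⟩ with h2 | h2
          · exact absurd (hB h2) (not_mem_T₂_of_mem_T₁ (hA h1))
          · exact h2
        · exact h1
      · exact Or.inr (Or.inl (by rw [hi, p.getVert_length]))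

theorem mem_matchingPart (h : G.IsSuccessor R (A ∪ G.S) (B ∪ G.S) d) (hA : A ⊆ G.T₁)
    (hB : B ⊆ G.T₂) {u w : V} (huw : R u w) (hwu : R w u) :
    s(u, w) ∈ G.matchingPart {e | ∃ u w, R u w ∧ e = s(u, w)} := by
  have hS : ∀ x y, R x y → R y x → x ∈ G.S := by
    intro x y hxy hyx
    rcases (h.dom x).1 ⟨_, hxy⟩ with h1 | h1
    · rcases (h.ran x).1 ⟨_, hyx⟩ with h2 | h2
      · exact absurd (hB h2) (not_mem_T₂_of_mem_T₁ (hA h1))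
      · exact h2
    · exact h1
  have hf : ∀ z z' x y, R z z' → R z' z → R x y → z ∈ s(x, y) → s(x, y) = s(z, z') := by
    intro z z' x y h1 h2 hxy hz
    rcases Sym2.mem_iff.1 hz with rfl | rfl
    · rw [h.right_unique hxy h1]
    · rw [h.left_unique hxy h2, Sym2.eq_swap]
  refine ⟨⟨u, w, huw, rfl⟩, ?_, ?_⟩
  · intro x hx
    rcases Sym2.mem_iff.1 hx with rfl | rfl
    · exact hS _ _ huw hwu
    · exact hS _ _ hwu huw
  · rintro _ ⟨x, y, hxy, rfl⟩ z hz hzf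
    rcases Sym2.mem_iff.1 hz with rfl | rfl
    · exact hf _ _ _ _ huw hwu hxy hzf
    · rw [hf _ _ _ _ hwu huw hxy hzf, Sym2.eq_swap]

theorem isPathMatching (h : G.IsSuccessor R (A ∪ G.S) (B ∪ G.S) d) (hA : A ⊆ G.T₁)
    (hB : B ⊆ G.T₂) : G.IsPathMatching {e | ∃ u w, R u w ∧ e = s(u, w)} := by
  refine ⟨?_, ?_⟩
  · rintro _ ⟨u, w, huw, rfl⟩
    exact h.adj huw
  · rintro _ ⟨u, w, huw, rfl⟩
    by_cases hwu : R w u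
    · exact Or.inl (h.mem_matchingPart hA hB huw hwu)
    · obtain ⟨a, ha, v, hv, p, hp, hep⟩ := h.exists_walk_from_T₁ hA hB u w huw hwu
      exact Or.inr ⟨a, ha, v, hv, p, h.isPathOf hA hB ha hv hp, hep⟩

theorem bd₁_eq (h : G.IsSuccessor R (A ∪ G.S) (B ∪ G.S) d) (hA : A ⊆ G.T₁) (hB : B ⊆ G.T₂) :
    G.bd₁ {e | ∃ u w, R u w ∧ e = s(u, w)} = A := by
  ext v
  constructor
  · rintro ⟨hv, _, ⟨u, w, huw, rfl⟩, hve⟩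
    rcases Sym2.mem_iff.1 hve with rfl | rfl
    · exact ((h.dom v).1 ⟨w, huw⟩).resolve_right (not_mem_S_of_mem_T₁ hv)
    · rcases (h.ran v).1 ⟨u, huw⟩ with h1 | h1
      · exact absurd (hB h1) (not_mem_T₂_of_mem_T₁ hv)
      · exact absurd h1 (not_mem_S_of_mem_T₁ hv)
  · intro hv
    obtain ⟨w, hw⟩ := (h.dom v).2 (Or.inl hv)
    exact ⟨hA hv, _, ⟨v, w, hw, rfl⟩, Sym2.mem_mk_left _ _⟩

theorem bd₂_eq (h : G.IsSuccessor R (A ∪ G.S) (B ∪ G.S) d) (hA : A ⊆ G.T₁) (hB : B ⊆ G.T₂) :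
    G.bd₂ {e | ∃ u w, R u w ∧ e = s(u, w)} = B := by
  ext v
  constructor
  · rintro ⟨hv, _, ⟨u, w, huw, rfl⟩, hve⟩
    rcases Sym2.mem_iff.1 hve with rfl | rfl
    · rcases (h.dom v).1 ⟨w, huw⟩ with h1 | h1
      · exact absurd hv (not_mem_T₂_of_mem_T₁ (hA h1))
      · exact absurd h1 (not_mem_S_of_mem_T₂ hv)
    · exact ((h.ran v).1 ⟨u, huw⟩).resolve_right (not_mem_S_of_mem_T₂ hv)
  · intro hv
    obtain ⟨w, hw⟩ := (h.ran v).2 (Or.inl hv)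
    exact ⟨hB hv, _, ⟨w, v, hw, rfl⟩, Sym2.mem_mk_right _ _⟩

theorem bdS_eq (h : G.IsSuccessor R (A ∪ G.S) (B ∪ G.S) d) :
    G.bdS {e | ∃ u w, R u w ∧ e = s(u, w)} = G.S := by
  ext v
  refine ⟨fun hv => hv.1, fun hv => ?_⟩
  obtain ⟨w, hw⟩ := (h.dom v).2 (Or.inr hv)
  exact ⟨hv, _, ⟨v, w, hw, rfl⟩, Sym2.mem_mk_left _ _⟩

end IsSuccessor

theorem IsPathMatching.isPartialPathMatching {M : Set (Sym2 V)} (hM : G.IsPathMatching M) :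
    G.IsPartialPathMatching M := by
  refine ⟨hM.1, fun e he => ?_⟩
  rcases hM.2 e he with h | ⟨u, hu, v, hv, p, hp, hep⟩
  · exact Or.inl h
  · exact Or.inr ⟨u, v, p, Or.inl ⟨hu, hv⟩, hp, hep⟩

/-- The first edge of the path is not a matching edge, so it lies on a $T_1$–$T_2$ path, and two
oriented paths with a common vertex coincide. -/
theorem IsPathMatching.exists_T₂_end {M : Set (Sym2 V)} (hM : G.IsPathMatching M) {a c : V}
    {p : G.graph.Walk a c} (hac : G.IsOriented a c) (hp : G.IsPathOf M p) :
    a ∈ G.T₁ ∧ c ∈ G.T₂ := by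
  have hl : 0 < p.length := by
    rw [Nat.pos_iff_ne_zero]
    intro h
    have := Walk.eq_of_length_eq_zero h
    subst this
    rcases hac with h | h | h
    · exact not_mem_T₂_of_mem_T₁ h.1 h.2
    · exact not_mem_S_of_mem_T₁ h.1 h.2
    · exact not_mem_S_of_mem_T₂ h.2 h.1
  have he := p.mk_getVert_mem_edges hl
  rcases hM.2 _ (hp.2.1 _ he) with h | ⟨u, hu, v, hv, q, hq, hqe⟩
  · exact absurd (p.getVert_mem_support 0)
      (not_mem_support_of_mem_matchingPart hac hp.2.1 h (Sym2.mem_mk_left _ _))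
  · obtain ⟨j, hj1, hj⟩ := Walk.mem_support_iff_exists_getVert.1
      (q.fst_mem_support_of_mem_edges hqe)
    obtain ⟨h1, h2, h3⟩ := hp.eq_of_common hac (Or.inl ⟨hu, hv⟩) hq (Nat.zero_le _) hj hj1.symm
    have h4 := h3 0 (Nat.zero_le _)
    have h5 := h3 _ le_rfl
    rw [p.getVert_zero, q.getVert_zero] at h4
    rw [p.getVert_length, h2, q.getVert_length] at h5
    exact ⟨h4 ▸ hu, h5 ▸ hv⟩

theorem IsPathMatching.C₁_eq_empty {M : Set (Sym2 V)} (hM : G.IsPathMatching M) : G.C₁ M = ∅ := by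
  rw [Set.eq_empty_iff_forall_notMem]
  intro c hc
  obtain ⟨hS, a, p, hac, hp⟩ := mem_C₁_iff.1 hc
  exact not_mem_S_of_mem_T₂ (hM.exists_T₂_end hac hp).2 hS

theorem IsPathMatching.C₂_eq_empty {M : Set (Sym2 V)} (hM : G.IsPathMatching M) : G.C₂ M = ∅ := by
  rw [Set.eq_empty_iff_forall_notMem]
  intro c hc
  obtain ⟨hS, a, p, hac, hp⟩ := mem_C₂_iff.1 hc
  exact not_mem_S_of_mem_T₁ (hM.exists_T₂_end hac hp).1 hS

/-- The successor relation of a basic path-matching. -/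
theorem IsBasicPathMatching.exists_isSuccessor {M : Set (Sym2 V)} (hM : G.IsBasicPathMatching M) :
    ∃ d, G.IsSuccessor (G.Succ M) (G.bd₁ M ∪ G.S) (G.bd₂ M ∪ G.S) d := by
  obtain ⟨d, hd, -⟩ := G.exists_rank M
  have := hM.1.isPartialPathMatching.isSuccessor hd
  rw [hM.1.C₁_eq_empty, hM.1.C₂_eq_empty, hM.2.2.2, Set.sdiff_empty] at this
  exact ⟨d, this⟩

end BPMInstance

/-! ### Linear algebra of represented bases -/

theorem linearIndepOn_iff_forall_sum_eq_zero {ι κ K : Type*} [Fintype ι] [Field K]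
    (f : ι → κ → K) (J : Set ι) : LinearIndepOn K f J ↔
      ∀ g : ι → K, (∀ i ∉ J, g i = 0) → (∀ k, ∑ i, g i * f i k = 0) → ∀ i, g i = 0 := by
  classical
  rw [linearIndepOn_iff'']
  constructor
  · intro h g hg hs i
    by_cases hi : i ∈ J
    · refine h (Finset.univ.filter (· ∈ J)) g (by simp) (fun i hi => hg i (by simpa using hi)) ?_ i
        (by simpa using hi)
      ext k
      rw [Finset.sum_apply, Pi.zero_apply, ← hs k, Finset.sum_filter]
      refine Finset.sum_congr rfl fun i _ => ?_
      split_ifs with h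
      · rfl
      · rw [hg i h, zero_mul]
    · exact hg i hi
  · intro h t g ht hg hs i _
    refine h g (fun i hi => hg i fun hit => hi (ht hit)) (fun k => ?_) i
    have := congrFun hs k
    rw [Finset.sum_apply, Pi.zero_apply] at this
    rw [← this]
    symm
    refine Finset.sum_subset (Finset.subset_univ t) fun i _ hi => ?_
    simp [hg i hi]

/-- The `r` independent rows span, so a linear functional vanishing on them is zero. -/
theorem LinearIndepOn.eq_zero_of_sum_mul_eq_zero {ι K : Type*} [Field K] {r : ℕ}
    {f : ι → Fin r → K} {J : Set ι} (h : LinearIndepOn K f J) (hJ : Nat.card J = r)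
    (hfin : J.Finite) {y : Fin r → K} (hy : ∀ i ∈ J, ∑ k, f i k * y k = 0) (k : Fin r) :
    y k = 0 := by
  have : Fintype J := hfin.fintype
  have hspan := LinearIndependent.span_eq_top_of_card_eq_finrank' (b := fun i : J => f i) h
    (by rw [Module.finrank_fin_fun, ← hJ, Nat.card_eq_fintype_card])
  let ℓ : (Fin r → K) →ₗ[K] K := Fintype.linearCombination K y
  have hℓ : ∀ x, ℓ x = ∑ k, x k * y k := fun x => by
    simp [ℓ, Fintype.linearCombination_apply]
  have h1 : Submodule.span K (Set.range fun i : J => f i) ≤ LinearMap.ker ℓ := by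
    rw [Submodule.span_le]
    rintro _ ⟨i, rfl⟩
    rw [SetLike.mem_coe, LinearMap.mem_ker, hℓ]
    exact hy i i.2
  rw [hspan] at h1
  have h2 : ℓ (Pi.single k 1) = 0 := LinearMap.mem_ker.1 (h1 Submodule.mem_top)
  rw [hℓ] at h2
  simpa [Pi.single_apply] using h2

theorem Fintype.sum_coe_mul_eq_sum_dite {V K : Type*} [Fintype V] [CommRing K] (s : Set V)
    [Fintype s] [DecidablePred (· ∈ s)] (f : V → K) (g : s → K) :
    ∑ v : s, f v * g v = ∑ v : V, f v * if h : v ∈ s then g ⟨v, h⟩ else 0 := by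
  have h1 : ∀ v : s, f v * g v = (fun v : V => f v * if h : v ∈ s then g ⟨v, h⟩ else 0) v := by
    intro v
    simp
  rw [Finset.sum_congr rfl fun v _ => h1 v, ← Finset.sum_subtype s.toFinset
    (fun _ => Set.mem_toFinset) (fun v => f v * if h : v ∈ s then g ⟨v, h⟩ else 0)]
  refine Finset.sum_subset (Finset.subset_univ _) fun v _ hv => ?_
  rw [Set.mem_toFinset] at hv
  simp [hv]

theorem Fintype.sum_coe_eq_sum_add_sum_sdiff {V K : Type*} [AddCommMonoid K] {s t : Set V}
    (hst : s ⊆ t) [Fintype s] [Fintype t] [Fintype ↥(t \ s)] (f : t → K) :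
    ∑ v : t, f v = ∑ v : s, f ⟨v, hst v.2⟩ + ∑ v : ↥(t \ s), f ⟨v, v.2.1⟩ := by
  classical
  rw [← Equiv.sum_comp (Equiv.Set.sumDiffSubset hst), Fintype.sum_sum_type]
  rfl

/-! ### Extensible implies non-singular, by specialization -/

namespace BPMInstance

variable {V : Type*} [Finite V] {G : BPMInstance V}

theorem isNonsingular_of_ker_eq_bot {m n R K : Type*} [Finite m] [Fintype n] [CommRing R] [Field K]
    (A : Matrix m n R) (φ : R →+* K) (hcard : Nat.card m = Nat.card n)
    (h : ∀ w : n → K, (∀ i, ∑ j, φ (A i j) * w j = 0) → ∀ j, w j = 0) : IsNonsingular A := by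
  have : Fintype m := Fintype.ofFinite m
  refine ⟨Nat.card m, (Finite.equivFin m).symm, (Finite.equivFinOfCardEq hcard.symm).symm, ?_⟩
  set e := (Finite.equivFin m).symm
  set f := (Finite.equivFinOfCardEq hcard.symm).symm
  intro hdet
  have h1 : (φ.mapMatrix (A.submatrix e f)).det = 0 := by
    rw [← RingHom.map_det, hdet, map_zero]
  obtain ⟨v, hv, hv0⟩ := Matrix.exists_mulVec_eq_zero_iff.2 h1
  apply hv
  ext j
  have := h (fun c => v (f.symm c)) (fun i => ?_) (f j)
  · simpa using this
  · have h2 := congrFun hv0 (e.symm i)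
    rw [Pi.zero_apply, Matrix.mulVec, dotProduct] at h2
    rw [← h2]
    refine (Fintype.sum_equiv f _ _ fun j => ?_).symm
    simp

theorem bd₁_subset {M : Set (Sym2 V)} : G.bd₁ M ⊆ G.T₁ := fun _ h => h.1

theorem bd₂_subset {M : Set (Sym2 V)} : G.bd₂ M ⊆ G.T₂ := fun _ h => h.1

theorem bdS_subset {M : Set (Sym2 V)} : G.bdS M ⊆ G.S := fun _ h => h.1

theorem IsSuccessor.ncard_eq {R : V → V → Prop} {P Q : Set V} {d : V → ℕ ×ₗ ℕ}
    (h : G.IsSuccessor R P Q d) : P.ncard = Q.ncard := by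
  have hs : ∀ a (ha : a ∈ P), R a ((h.dom a).2 ha).choose := fun a ha =>
    ((h.dom a).2 ha).choose_spec
  refine Set.ncard_congr (fun a ha => ((h.dom a).2 ha).choose) ?_ ?_ ?_
  · exact fun a ha => (h.ran _).1 ⟨a, hs a ha⟩
  · intro a b ha hb hab
    have h1 := hs b hb
    rw [← hab] at h1
    exact h.left_unique (hs a ha) h1
  · intro b hb
    obtain ⟨a, hab⟩ := (h.ran b).2 hb
    have ha := (h.dom a).1 ⟨b, hab⟩
    exact ⟨a, ha, h.right_unique (hs a ha) hab⟩

/-- The successor bijection of `M` gives $|\partial_1M|+|\partial_SM\setminus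
C_1|=|\partial_2M|+|\partial_SM\setminus C_2|$; with $|T_1|=|T_2|$ this balances the blocks. -/
theorem IsPartialPathMatching.card_zRow_eq {M : Set (Sym2 V)} (hM : G.IsPartialPathMatching M) :
    Nat.card (G.ZRow M) = Nat.card (G.ZCol M) := by
  obtain ⟨d, hd, -⟩ := G.exists_rank M
  have h := (hM.isSuccessor hd).ncard_eq
  have hS : ∀ T B : Set V, Disjoint T G.S → B ⊆ T → ∀ C, Disjoint B (G.bdS M \ C) :=
    fun T B hT hB C => hT.mono hB (fun x hx => bdS_subset hx.1)
  rw [Set.ncard_union_eq (hS _ _ G.disjoint_T₁_S bd₁_subset _),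
    Set.ncard_union_eq (hS _ _ G.disjoint_T₂_S bd₂_subset _)] at h
  have hC : ∀ C ⊆ G.bdS M, Disjoint C (G.S \ G.bdS M) := fun C hC =>
    Set.disjoint_left.2 fun x hx hx' => hx'.2 (hC hx)
  have e1 := Set.ncard_sdiff_add_ncard_of_subset (C₁_subset_bdS (G := G) (M := M))
  have e2 := Set.ncard_sdiff_add_ncard_of_subset (C₂_subset_bdS (G := G) (M := M))
  have e3 := Set.ncard_sdiff_add_ncard_of_subset (bd₁_subset (G := G) (M := M))
  have e4 := Set.ncard_sdiff_add_ncard_of_subset (bd₂_subset (G := G) (M := M))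
  have e5 := G.card_eq
  simp only [Nat.card_sum, Nat.card_coe_set_eq, Set.ncard_union_eq (hC _ C₁_subset_bdS),
    Set.ncard_union_eq (hC _ C₂_subset_bdS)]
  omega

theorem bd₁_mono {M M' : Set (Sym2 V)} (h : M ⊆ M') : G.bd₁ M ⊆ G.bd₁ M' :=
  fun _ ⟨hv, e, he, hve⟩ => ⟨hv, e, h he, hve⟩

open Classical in
/-- The specialization of the indeterminates given by a basic path-matching. -/
noncomputable def indicatorEval (G : BPMInstance V) (F : Type*) [Field F] (M : Set (Sym2 V)) :
    MvPolynomial (Indet V) F →+* F :=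
  MvPolynomial.eval fun
    | .edge e => if e ∈ M then 1 else 0
    | .diag₁ v => if v ∈ G.bd₁ M then 0 else 1
    | .diag₂ v => if v ∈ G.bd₂ M then 0 else 1

variable {F : Type*} [Field F]

@[simp] theorem indicatorEval_C {M : Set (Sym2 V)} (a : F) :
    G.indicatorEval F M (MvPolynomial.C a) = a := by
  simp [indicatorEval]

open Classical in
@[simp] theorem indicatorEval_diag₁ {M : Set (Sym2 V)} (v : V) :
    G.indicatorEval F M (MvPolynomial.X (Indet.diag₁ v)) = if v ∈ G.bd₁ M then 0 else 1 := by
  simp [indicatorEval]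

open Classical in
@[simp] theorem indicatorEval_diag₂ {M : Set (Sym2 V)} (v : V) :
    G.indicatorEval F M (MvPolynomial.X (Indet.diag₂ v)) = if v ∈ G.bd₂ M then 0 else 1 := by
  simp [indicatorEval]

theorem indicatorEval_X_eq_zero {M : Set (Sym2 V)} (sgn : V → V → ℤˣ) {u v : V}
    (h : s(u, v) ∉ M) : G.indicatorEval F M (G.X F sgn u v) = 0 := by
  rw [X, Matrix.of_apply]
  split_ifs
  · simp [indicatorEval, h]
  · simp

theorem indicatorEval_X_ne_zero {M : Set (Sym2 V)} (sgn : V → V → ℤˣ) {u v : V}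
    (hadj : G.graph.Adj u v) (h : s(u, v) ∈ M) : G.indicatorEval F M (G.X F sgn u v) ≠ 0 := by
  rw [X, Matrix.of_apply, if_pos hadj]
  rcases Int.units_eq_one_or (sgn u v) with h1 | h1 <;> simp [indicatorEval, h, h1]

theorem Represents₁.linearIndepOn {Q₁ : Matrix (Fin G.r) G.T₁ F} (hQ₁ : G.Represents₁ Q₁)
    {A : Set V} (hA : A ⊆ G.T₁) (hind : G.M₁.Indep A) :
    LinearIndepOn F (fun v i => Q₁ i v) (Subtype.val ⁻¹' A) := by
  rw [← hQ₁, Subtype.image_preimage_coe, Set.inter_eq_right.2 hA]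
  exact hind

theorem Represents₂.linearIndepOn {Q₂ : Matrix G.T₂ (Fin G.r) F} (hQ₂ : G.Represents₂ Q₂)
    {B : Set V} (hB : B ⊆ G.T₂) (hind : G.M₂.Indep B) :
    LinearIndepOn F (fun v i => Q₂ v i) (Subtype.val ⁻¹' B) := by
  rw [← hQ₂, Subtype.image_preimage_coe, Set.inter_eq_right.2 hB]
  exact hind

/-- A linear system along the edges of a basic path-matching has only the trivial solution. -/
theorem IsSuccessor.eq_zero_of_forall_sum {K : Type*} [Field K] [Fintype V] {R : V → V → Prop}
    {P Q : Set V} {d : V → ℕ ×ₗ ℕ} (h : G.IsSuccessor R P Q d) (x : V → V → K) (y : V → K)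
    (hx : ∀ u v, R u v → x u v ≠ 0) (hx' : ∀ u v, x u v ≠ 0 → R u v ∨ R v u)
    (hy : ∀ v, y v ≠ 0 → ∃ u, R u v ∧ ∑ v', x u v' * y v' = 0) (v : V) : y v = 0 := by
  induction v using (wellFounded_rank d).induction with
  | _ v ih =>
    by_contra hv
    obtain ⟨u, huv, hsum⟩ := hy v hv
    rw [Finset.sum_eq_single v] at hsum
    · exact (mul_ne_zero (hx u v huv) hv) hsum
    · intro v' _ hne
      by_cases hxv : x u v' = 0
      · rw [hxv, zero_mul]
      · rcases hx' u v' hxv with h1 | h1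
        · exact absurd (h.right_unique h1 huv) hne
        -- Here $v'$ is the predecessor of $u$. Unless it equals $v$, the rank gives
        -- $d(v')<d(u)<d(v)$ and induction applies.
        · rcases h.rank huv with h2 | h2
          · exact absurd (h.left_unique h1 h2) hne
          · rcases h.rank h1 with h3 | h3
            · exact absurd (h.right_unique h3 huv) hne
            · rw [ih v' (h3.trans h2), mul_zero]
    · simp

theorem IsExtensible.isNonsingular {Q₁ : Matrix (Fin G.r) G.T₁ F} (hQ₁ : G.Represents₁ Q₁)
    {Q₂ : Matrix G.T₂ (Fin G.r) F} (hQ₂ : G.Represents₂ Q₂) (sgn : V → V → ℤˣ)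
    {M : Set (Sym2 V)} (hM : G.IsPartialPathMatching M) (hext : G.IsExtensible M) :
    IsNonsingular (G.Z Q₁ Q₂ sgn M) := by
  classical
  obtain ⟨M', hM', hsub, hmat⟩ := hext
  obtain ⟨d', hR'⟩ := hM'.exists_isSuccessor
  obtain ⟨d, hd, -⟩ := G.exists_rank M
  have hR := hM.isSuccessor hd
  have hmono : ∀ {u w}, G.Succ M u w → G.Succ M' u w :=
    fun h => h.mono hM'.1.isPartialPathMatching hsub hmat
  have : Fintype V := Fintype.ofFinite V
  let : ∀ s : Set V, Fintype s := fun s => Fintype.ofFinite s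
  refine isNonsingular_of_ker_eq_bot _ (G.indicatorEval F M') hM.card_zRow_eq fun w hw => ?_
  have row1 := fun k : Fin G.r => hw (.inl k)
  have row2 := fun u => hw (.inr (.inl u))
  have row3 := fun u => hw (.inr (.inr (.inl u)))
  have row4 := fun u => hw (.inr (.inr (.inr (.inl u))))
  have row5 := fun u => hw (.inr (.inr (.inr (.inr u))))
  simp only [Z, Matrix.of_apply, Fintype.sum_sum_type, map_zero, zero_mul,
    Finset.sum_const_zero, add_zero, zero_add, one_mul, indicatorEval_C, apply_ite (G.indicatorEval F M'),
    indicatorEval_diag₁, indicatorEval_diag₂, ite_mul, Finset.sum_ite_eq, Finset.mem_univ,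
    if_true] at row1 row2 row3 row4 row5
  have hA : G.bd₁ M' ⊆ G.T₁ := bd₁_subset
  have hB : G.bd₂ M' ⊆ G.T₂ := bd₂_subset
  -- the block of columns `Fin r`
  have y0 : ∀ k, w (.inl k) = 0 := by
    refine (hQ₂.linearIndepOn hB hM'.2.2.1.indep).eq_zero_of_sum_mul_eq_zero ?_ (Set.toFinite _)
      (y := fun k => w (.inl k)) fun u hu => ?_
    · have h1 := hM'.2.2.1.encard_eq_eRank
      rw [G.rank₂] at h1
      rw [Nat.card_coe_set_eq, Set.ncard_preimage_of_injective_subset_range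
        Subtype.val_injective (by simpa using hB), Set.ncard_def, h1, ENat.toNat_natCast]
    · by_cases hu' : (u : V) ∈ G.bd₂ M
      · exact row2 ⟨u, hu'⟩
      · have := row3 ⟨u, u.2, hu'⟩
        rw [if_pos (show (u : V) ∈ G.bd₂ M' from hu), add_zero] at this
        exact this
  simp only [y0, mul_zero, Finset.sum_const_zero, zero_add, ite_eq_left_iff] at row3
  have hcov : ∀ u v, G.Succ M' u v ∨ G.Succ M' v u ↔ s(u, v) ∈ M' := by
    intro u v
    refine ⟨?_, hM'.1.isPartialPathMatching.succ_or_succ⟩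
    rintro (h | h)
    · exact h.mem
    · exact Sym2.eq_swap ▸ h.mem
  have hX : ∀ u v, G.indicatorEval F M' (G.X F sgn u v) ≠ 0 → G.Succ M' u v ∨ G.Succ M' v u := by
    intro u v h
    rw [hcov]
    by_contra h'
    exact h (indicatorEval_X_eq_zero sgn h')
  -- the columns of `T₁`
  have a0 : ∀ u (hu : u ∈ G.T₁ \ G.bd₁ M), u ∉ G.bd₁ M' →
      w (.inr (.inr (.inl ⟨u, hu⟩))) = 0 := by
    intro u hu hu'
    -- No edge of `M'` meets $u$, so its $X$-row vanishes while its $D_1$-entry becomes $1$.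
    have h0 : ∀ v, G.indicatorEval F M' (G.X F sgn u v) = 0 := fun v =>
      indicatorEval_X_eq_zero sgn fun h => hu' ⟨hu.1, _, h, Sym2.mem_mk_left _ _⟩
    have := row4 ⟨u, hu⟩
    simpa [h0, if_neg hu'] using this
  have ha : ∀ v : G.T₁, (if h : (v : V) ∈ G.bd₁ M then w (.inr (.inl ⟨v, h⟩))
      else w (.inr (.inr (.inl ⟨v, v.2, h⟩)))) = 0 := by
    refine (linearIndepOn_iff_forall_sum_eq_zero _ _).1
      (hQ₁.linearIndepOn hA hM'.2.1.indep) _ ?_ ?_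
    · intro v hv
      have hv' : (v : V) ∉ G.bd₁ M := fun h => hv (bd₁_mono hsub h)
      rw [dif_neg hv']
      exact a0 v _ hv
    · intro k
      rw [Fintype.sum_coe_eq_sum_add_sum_sdiff (bd₁_subset (G := G) (M := M)), ← row1 k]
      congr 1
      · refine Finset.sum_congr rfl fun v _ => ?_
        rw [dif_pos v.2, mul_comm]
      · refine Finset.sum_congr rfl fun v _ => ?_
        rw [dif_neg v.2.2, mul_comm]
  have a1 : ∀ v, w (.inr (.inl v)) = 0 := fun v => by
    simpa [v.2] using ha ⟨v, bd₁_subset v.2⟩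
  have a2 : ∀ v, w (.inr (.inr (.inl v))) = 0 := fun v => by
    have := ha ⟨v, v.2.1⟩
    rwa [dif_neg v.2.2] at this
  simp only [a2, ite_self, zero_add] at row4
  -- the remaining columns
  have hsum : ∀ u, ∑ v : ↥(G.T₂ \ G.bd₂ M), G.indicatorEval F M' (G.X F sgn u v) *
        w (.inr (.inr (.inr (.inl v)))) + ∑ v : ↥(G.C₂ M ∪ (G.S \ G.bdS M)),
        G.indicatorEval F M' (G.X F sgn u v) * w (.inr (.inr (.inr (.inr v)))) =
      ∑ v, G.indicatorEval F M' (G.X F sgn u v) *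
        ((if h : v ∈ G.T₂ \ G.bd₂ M then w (.inr (.inr (.inr (.inl ⟨v, h⟩)))) else 0) +
          if h : v ∈ G.C₂ M ∪ (G.S \ G.bdS M) then w (.inr (.inr (.inr (.inr ⟨v, h⟩)))) else 0) := by
    intro u
    simp only [mul_add, Finset.sum_add_distrib]
    rw [Fintype.sum_coe_mul_eq_sum_dite _ (fun v => G.indicatorEval F M' (G.X F sgn u v)),
      Fintype.sum_coe_mul_eq_sum_dite _ (fun v => G.indicatorEval F M' (G.X F sgn u v))]
  have hy := hR'.eq_zero_of_forall_sum (fun u v => G.indicatorEval F M' (G.X F sgn u v))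
    (fun v => (if h : v ∈ G.T₂ \ G.bd₂ M then w (.inr (.inr (.inr (.inl ⟨v, h⟩)))) else 0) +
      if h : v ∈ G.C₂ M ∪ (G.S \ G.bdS M) then w (.inr (.inr (.inr (.inr ⟨v, h⟩)))) else 0)
    (fun u v h => indicatorEval_X_ne_zero sgn (hR'.adj h) h.mem) hX ?_
  · have hdisj : ∀ v ∈ G.T₂ \ G.bd₂ M, v ∉ G.C₂ M ∪ (G.S \ G.bdS M) := by
      rintro v hv (h | h)
      · exact not_mem_S_of_mem_T₂ hv.1 h.1
      · exact not_mem_S_of_mem_T₂ hv.1 h.1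
    rintro (k | v | v | ⟨v, hv⟩ | ⟨v, hv⟩)
    · exact y0 k
    · exact a1 v
    · exact a2 v
    · have := hy v
      rwa [dif_pos hv, dif_neg (hdisj v hv), add_zero] at this
    · have := hy v
      rwa [dif_pos hv, dif_neg (fun h => hdisj v h hv), zero_add] at this
  · intro v hv
    -- A column that may carry a nonzero coordinate belongs to a vertex with a predecessor $u$ in
    -- `M'` but none in `M`. By `Succ.mono` and uniqueness, $u$ has no successor in `M`, so $u$
    -- indexes a row of `Z(M)`, which supplies the equation needed.
    have hvR : v ∈ G.bd₂ M' ∪ G.S ∧ v ∉ G.bd₂ M ∪ (G.bdS M \ G.C₂ M) := by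
      by_cases h1 : v ∈ G.T₂ \ G.bd₂ M
      · refine ⟨Or.inl ?_, ?_⟩
        · by_contra h2
          rw [dif_pos h1, row3 ⟨v, h1⟩ h2, zero_add, dif_neg] at hv
          · exact hv rfl
          · rintro (h | h)
            · exact not_mem_S_of_mem_T₂ h1.1 h.1
            · exact not_mem_S_of_mem_T₂ h1.1 h.1
        · rintro (h | h)
          · exact h1.2 h
          · exact not_mem_S_of_mem_T₂ h1.1 h.1.1
      · by_cases h2 : v ∈ G.C₂ M ∪ (G.S \ G.bdS M)
        · have hS : v ∈ G.S := by
            rcases h2 with h | h <;> exact h.1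
          refine ⟨Or.inr hS, ?_⟩
          rintro (h | h)
          · exact not_mem_S_of_mem_T₂ h.1 hS
          · rcases h2 with h2 | h2
            · exact h.2 h2
            · exact h2.2 h.1
        · rw [dif_neg h1, dif_neg h2, add_zero] at hv
          exact absurd rfl hv
    obtain ⟨u, huv⟩ := (hR'.ran v).2 hvR.1
    refine ⟨u, huv, ?_⟩
    have hu1 := (hR'.dom u).1 ⟨v, huv⟩
    have hu2 : u ∉ G.bd₁ M ∪ (G.bdS M \ G.C₁ M) := by
      rw [← hR.dom u]
      rintro ⟨x, hx⟩
      apply hvR.2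
      rw [← hR.ran v]
      rw [(hmono hx).right_unique huv] at hx
      exact ⟨u, hx⟩
    rcases hu1 with h | h
    · exact (hsum u).symm.trans <| row4 ⟨u, bd₁_subset h, fun h' => hu2 (Or.inl h')⟩
    · refine (hsum u).symm.trans <| row5 ⟨u, ?_⟩
      by_cases hu : u ∈ G.bdS M
      · left
        by_contra hC
        exact hu2 (Or.inr ⟨hu, hC⟩)
      · exact Or.inr ⟨h, hu⟩

end BPMInstance

/-! ### Determinants with independently indexed rows and columns -/

namespace Matrix

variable {m n R : Type*} [CommRing R]

open Classical in
/-- Some choice, for each row, between the entries inside and the entries outside of `D` preserves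
a nonzero determinant. -/
theorem exists_det_restrict_ne_zero {k : ℕ} (A : Matrix m n R) (D : m → n → Prop)
    (e : Fin k ≃ m) (f : Fin k ≃ n) (hdet : (A.submatrix e f).det ≠ 0) :
    ∃ s : Set m, ((Matrix.of fun i j => if D i j ↔ i ∈ s then A i j else 0).submatrix e f).det
      ≠ 0 := by
  set P : Matrix (Fin k) (Fin k) R := fun i j => if D (e i) (f j) then A (e i) (f j) else 0
  set Q : Matrix (Fin k) (Fin k) R := fun i j => if D (e i) (f j) then 0 else A (e i) (f j)
  have hPQ : A.submatrix e f = P + Q := by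
    ext i j
    rw [submatrix_apply, add_apply]
    simp only [P, Q]
    split_ifs <;> simp
  -- Expand the determinant of a sum of two matrices by multilinearity in the rows; some summand
  -- survives.
  have h1 : (A.submatrix e f).det =
      ∑ t : Finset (Fin k), (detRowAlternating.toMultilinearMap : MultilinearMap R
        (fun _ : Fin k => Fin k → R) R) (t.piecewise P Q) := by
    rw [hPQ]
    exact (detRowAlternating.toMultilinearMap : MultilinearMap R
        (fun _ : Fin k => Fin k → R) R).map_add_univ P Q
  rw [h1] at hdet
  obtain ⟨t, -, ht⟩ := Finset.exists_ne_zero_of_sum_ne_zero hdet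
  refine ⟨{i | e.symm i ∈ t}, ?_⟩
  convert ht using 1
  change det _ = det _
  congr 1
  ext i j
  by_cases hi : i ∈ t
  · simp [Finset.piecewise, hi, P]
  · simp [Finset.piecewise, hi, Q, ite_not]

/-- A non-singular matrix that is alternating on the index set `ι` of some of its rows and some of
its columns has a transversal of nonzero entries all of whose cycles in `ι` have length two. -/
theorem exists_equiv_of_alternating_on {ι : Type*} {k : ℕ} (A : Matrix m n R) (e : Fin k ≃ m)
    (f : Fin k ≃ n) (hdet : (A.submatrix e f).det ≠ 0) (a : ι → m) (b : ι → n)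
    (ha : Function.Injective a) (hb : Function.Injective b)
    (hskew : ∀ x y, A (a y) (b x) = - A (a x) (b y)) (hdiag : ∀ x, A (a x) (b x) = 0) :
    ∃ (τ : m ≃ n) (d : ι → ℕ), (∀ i, A i (τ i) ≠ 0) ∧
      ∀ x y, τ (a x) = b y → τ (a y) = b x ∨ d x < d y := by
  classical
  have ha' : Function.Injective fun x => e.symm (a x) := e.symm.injective.comp ha
  have hb' : Function.Injective fun x => f.symm (b x) := f.symm.injective.comp hb
  -- Cycles make sense only once rows and columns are identified. A column permutation, which costs
  -- at most a sign, places column `b x` opposite row `a x`.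
  let ε : {i // i ∈ Set.range fun x => e.symm (a x)} ≃ {i // i ∈ Set.range fun x => f.symm (b x)} :=
    (Equiv.ofInjective _ ha').symm.trans (Equiv.ofInjective _ hb')
  let σ : Equiv.Perm (Fin k) := ε.extendSubtype
  have hσ : ∀ x, σ (e.symm (a x)) = f.symm (b x) := by
    intro x
    rw [Equiv.extendSubtype_apply_of_mem ε _ ⟨x, rfl⟩]
    have : (⟨e.symm (a x), ⟨x, rfl⟩⟩ : {i // i ∈ Set.range fun x => e.symm (a x)}) =
        Equiv.ofInjective _ ha' x := rfl
    simp only [ε, Equiv.trans_apply]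
    rw [this, Equiv.symm_apply_apply]
    rfl
  let f' : Fin k ≃ n := σ.trans f
  have hf' : ∀ x, f' (e.symm (a x)) = b x := by
    intro x
    simp [f', hσ]
  have hdet' : (A.submatrix e f').det ≠ 0 := by
    have h1 : A.submatrix e f' = (A.submatrix e f).submatrix id σ := rfl
    rw [h1, det_permute']
    rcases Int.units_eq_one_or (Equiv.Perm.sign σ) with h | h <;> simpa [h] using hdet
  obtain ⟨π, d, hπ, hd⟩ := exists_perm_of_alternating_on (A.submatrix e f')
    (Set.range fun x => e.symm (a x)) (by
      rintro _ ⟨x, rfl⟩ _ ⟨y, rfl⟩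
      simp [hf', hskew x y]) (by
      rintro _ ⟨x, rfl⟩
      simp [hf', hdiag x]) hdet'
  refine ⟨(e.symm.trans π).trans f', fun x => d (e.symm (a x)), ?_, ?_⟩
  · intro i
    simpa using hπ (e.symm i)
  · intro x y hxy
    simp only [Equiv.trans_apply] at hxy ⊢
    have h1 : π (e.symm (a x)) = e.symm (a y) := by
      rw [← hf' y] at hxy
      exact f'.injective hxy
    rcases hd _ ⟨x, rfl⟩ ⟨y, h1.symm⟩ with h | h
    · left
      rw [← h1, h, hf']
    · right
      rwa [h1] at h

theorem eq_zero_of_det_submatrix_ne_zero [IsDomain R] [Fintype n] {k : ℕ} {A : Matrix m n R}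
    {e : Fin k ≃ m} {f : Fin k ≃ n} (hdet : (A.submatrix e f).det ≠ 0) {w : n → R}
    (hw : ∀ i, ∑ j, A i j * w j = 0) (j : n) : w j = 0 := by
  by_contra hj
  apply hdet
  rw [← exists_mulVec_eq_zero_iff]
  refine ⟨fun i => w (f i), fun h => hj ?_, ?_⟩
  · simpa using congrFun h (f.symm j)
  · ext i
    rw [Pi.zero_apply, ← hw (e i), mulVec, dotProduct]
    exact Fintype.sum_equiv f _ _ fun _ => rfl

theorem exists_ne_zero_of_det_submatrix_ne_zero {k : ℕ} {A : Matrix m n R}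
    {e : Fin k ≃ m} {f : Fin k ≃ n} (hdet : (A.submatrix e f).det ≠ 0) (i : m) :
    ∃ j, A i j ≠ 0 := by
  by_contra! h
  exact hdet (det_eq_zero_of_row_eq_zero (e.symm i) fun j => by simp [h])

end Matrix

theorem Matroid.Indep.isBase_of_eRank_le_card {α : Type*} [Finite α] {M : Matroid α} {A : Set α}
    {r : ℕ} (hr : M.eRank = r) (h : M.Indep A) (hA : r ≤ A.ncard) : M.IsBase A := by
  refine h.isBase_of_eRk_ge A.toFinite ?_
  rw [hr, h.eRk_eq_encard, ← A.toFinite.cast_ncard_eq]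
  exact_mod_cast hA

/-! ### The bases chosen by a non-vanishing restriction of $Z(M)$ -/

namespace BPMInstance

variable {V : Type*} [Finite V] {G : BPMInstance V} {F : Type*} [Field F]

theorem X_swap {sgn : V → V → ℤˣ} (hsgn : G.IsSkewSign sgn) {u v : V} (hu : u ∈ G.S)
    (hv : v ∈ G.S) : G.X F sgn v u = - G.X F sgn u v := by
  simp only [X, Matrix.of_apply]
  by_cases h : G.graph.Adj u v
  · rw [if_pos h, if_pos h.symm, hsgn u hu v hv h, Sym2.eq_swap]
    simp
  · rw [if_neg h, if_neg fun h' => h h'.symm, neg_zero]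

theorem X_self (sgn : V → V → ℤˣ) (u : V) : G.X F sgn u u = 0 := by
  simp [X]

theorem adj_of_X_ne_zero {sgn : V → V → ℤˣ} {u v : V} (h : G.X F sgn u v ≠ 0) :
    G.graph.Adj u v := by
  by_contra h'
  exact h (by simp [X, h'])

/-- The position of an entry of `Z(M)` in one of the blocks `D₁` and `D₂`. -/
def InDiagBlock {M : Set (Sym2 V)} : G.ZRow M → G.ZCol M → Prop
  | .inr (.inr (.inl _)), .inr (.inr (.inr (.inl _))) => True
  | .inr (.inr (.inr (.inl _))), .inr (.inr (.inl _)) => True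
  | _, _ => False

open Classical in
/-- The matrix `Z(M)`, with only the entries of `D₁` and `D₂` kept in the rows in `s`, and with
these entries dropped in the other rows. -/
noncomputable def ZRestrict (Q₁ : Matrix (Fin G.r) G.T₁ F)
    (Q₂ : Matrix G.T₂ (Fin G.r) F) (sgn : V → V → ℤˣ) (M : Set (Sym2 V)) (s : Set (G.ZRow M)) :
    Matrix (G.ZRow M) (G.ZCol M) (MvPolynomial (Indet V) F) :=
  Matrix.of fun i j => if InDiagBlock i j ↔ i ∈ s then G.Z Q₁ Q₂ sgn M i j else 0

/-- The vertex of a row that meets the block `X`. -/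
def IsRowOf {M : Set (Sym2 V)} : G.ZRow M → V → Prop
  | .inr (.inr (.inr (.inl x))), u => x = u
  | .inr (.inr (.inr (.inr x))), u => x = u
  | _, _ => False

/-- The vertex of a column that meets the block `X`. -/
def IsColOf {M : Set (Sym2 V)} : G.ZCol M → V → Prop
  | .inr (.inr (.inr (.inl x))), u => x = u
  | .inr (.inr (.inr (.inr x))), u => x = u
  | _, _ => False

variable {M : Set (Sym2 V)}

theorem mem_S_of_mem_row {v : V} (h : v ∈ G.C₁ M ∪ (G.S \ G.bdS M)) : v ∈ G.S := by
  rcases h with h | h <;> exact h.1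

theorem mem_S_of_mem_col {v : V} (h : v ∈ G.C₂ M ∪ (G.S \ G.bdS M)) : v ∈ G.S := by
  rcases h with h | h <;> exact h.1

theorem IsRowOf.unique {i : G.ZRow M} {u u' : V} (h : IsRowOf i u) (h' : IsRowOf i u') :
    u = u' := by
  rcases i with i | i | i | i | i <;> simp only [IsRowOf] at h h' <;> exact h.symm.trans h'

theorem IsColOf.unique {i : G.ZCol M} {u u' : V} (h : IsColOf i u) (h' : IsColOf i u') :
    u = u' := by
  rcases i with i | i | i | i | i <;> simp only [IsColOf] at h h' <;> exact h.symm.trans h'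

theorem IsRowOf.row_unique {i i' : G.ZRow M} {u : V} (h : IsRowOf i u) (h' : IsRowOf i' u) :
    i = i' := by
  rcases i with i | i | i | i | i <;> rcases i' with i' | i' | i' | i' | i' <;>
    simp only [IsRowOf] at h h'
  · obtain rfl : i = i' := Subtype.ext (h.trans h'.symm)
    rfl
  · exact absurd (mem_S_of_mem_row i'.2) (h.trans h'.symm ▸ not_mem_S_of_mem_T₁ i.2.1)
  · exact absurd (mem_S_of_mem_row i.2) (h'.trans h.symm ▸ not_mem_S_of_mem_T₁ i'.2.1)
  · obtain rfl : i = i' := Subtype.ext (h.trans h'.symm)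
    rfl

theorem IsColOf.col_unique {i i' : G.ZCol M} {u : V} (h : IsColOf i u) (h' : IsColOf i' u) :
    i = i' := by
  rcases i with i | i | i | i | i <;> rcases i' with i' | i' | i' | i' | i' <;>
    simp only [IsColOf] at h h'
  · obtain rfl : i = i' := Subtype.ext (h.trans h'.symm)
    rfl
  · exact absurd (mem_S_of_mem_col i'.2) (h.trans h'.symm ▸ not_mem_S_of_mem_T₂ i.2.1)
  · exact absurd (mem_S_of_mem_col i.2) (h'.trans h.symm ▸ not_mem_S_of_mem_T₂ i'.2.1)
  · obtain rfl : i = i' := Subtype.ext (h.trans h'.symm)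
    rfl

/-- The vertices of `T₁` that are covered by `M` or whose row is not in `s`. -/
def base₁ (s : Set (G.ZRow M)) : Set V :=
  {v | v ∈ G.bd₁ M ∨ ∃ h : v ∈ G.T₁ \ G.bd₁ M, .inr (.inr (.inr (.inl ⟨v, h⟩))) ∉ s}

/-- The vertices of `T₂` that are covered by `M` or whose row is not in `s`. -/
def base₂ (s : Set (G.ZRow M)) : Set V :=
  {v | v ∈ G.bd₂ M ∨ ∃ h : v ∈ G.T₂ \ G.bd₂ M, .inr (.inr (.inl ⟨v, h⟩)) ∉ s}

theorem base₁_subset (s : Set (G.ZRow M)) : base₁ s ⊆ G.T₁ := by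
  rintro v (h | ⟨h, -⟩) <;> exact h.1

theorem base₂_subset (s : Set (G.ZRow M)) : base₂ s ⊆ G.T₂ := by
  rintro v (h | ⟨h, -⟩) <;> exact h.1

section

variable {Q₁ : Matrix (Fin G.r) G.T₁ F} {Q₂ : Matrix G.T₂ (Fin G.r) F} {sgn : V → V → ℤˣ}
  {s : Set (G.ZRow M)}

theorem zRestrict_ne_zero_iff {i : G.ZRow M} {j : G.ZCol M} :
    G.ZRestrict Q₁ Q₂ sgn M s i j ≠ 0 ↔
      (InDiagBlock i j ↔ i ∈ s) ∧ G.Z Q₁ Q₂ sgn M i j ≠ 0 := by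
  simp [ZRestrict]

/-- A dependency among these columns of $Q_1$, extended by zero, is a kernel vector: a row of $T_1$
in `s` sees only its own $D_1$-entry, where the dependency vanishes, and a row not in `s` has lost
that entry. This replaces a Cauchy–Binet expansion. -/
theorem indep_base₁ (hQ₁ : G.Represents₁ Q₁) {k : ℕ} {e : Fin k ≃ G.ZRow M}
    {f : Fin k ≃ G.ZCol M} (hdet : ((G.ZRestrict Q₁ Q₂ sgn M s).submatrix e f).det ≠ 0) :
    G.M₁.Indep (base₁ s) := by
  classical
  have : Fintype V := Fintype.ofFinite V
  let : ∀ s : Set V, Fintype s := fun s => Fintype.ofFinite s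
  have hval : Subtype.val '' (Subtype.val ⁻¹' base₁ s : Set G.T₁) = base₁ s := by
    rw [Subtype.image_preimage_coe, Set.inter_eq_right.2 (base₁_subset s)]
  rw [← hval, hQ₁, linearIndepOn_iff_forall_sum_eq_zero]
  intro g hg hsum
  have hw := Matrix.eq_zero_of_det_submatrix_ne_zero hdet (w := fun
    | .inr (.inl v) => MvPolynomial.C (g ⟨v, bd₁_subset v.2⟩)
    | .inr (.inr (.inl v)) => MvPolynomial.C (g ⟨v, v.2.1⟩)
    | _ => 0) ?_
  · intro v
    rw [← MvPolynomial.C_eq_zero (σ := Indet V)]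
    by_cases hv : (v : V) ∈ G.bd₁ M
    · exact hw (.inr (.inl ⟨v, hv⟩))
    · exact hw (.inr (.inr (.inl ⟨v, v.2, hv⟩)))
  · rintro (l | u | u | u | u)
    · by_cases hl : Sum.inl l ∈ s
      · simp [ZRestrict, InDiagBlock, hl]
      · have h1 := congrArg (MvPolynomial.C (σ := Indet V)) (hsum l)
        rw [Fintype.sum_coe_eq_sum_add_sum_sdiff (bd₁_subset (G := G) (M := M)), map_add, map_sum,
          map_sum, map_zero] at h1
        refine Eq.trans ?_ h1
        simp only [ZRestrict, Z, InDiagBlock, Matrix.of_apply, Fintype.sum_sum_type, hl, mul_zero,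
          Finset.sum_const_zero, zero_add, add_zero, iff_self, if_true]
        congr 1
        · refine Finset.sum_congr rfl fun v _ => ?_
          rw [map_mul, mul_comm]
        · refine Finset.sum_congr rfl fun v _ => ?_
          rw [map_mul, mul_comm]
    · refine Finset.sum_eq_zero fun j _ => ?_
      rcases j with j | j | j | j | j <;> simp [ZRestrict, Z]
    · refine Finset.sum_eq_zero fun j _ => ?_
      rcases j with j | j | j | j | j <;> simp [ZRestrict, Z]
    · refine Finset.sum_eq_zero fun j _ => ?_
      rcases j with j | j | j | j | j
      · simp
      · simp [ZRestrict, Z]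
      · simp only [ZRestrict, Z, InDiagBlock, Matrix.of_apply, true_iff]
        split_ifs with h1 h2
        · subst h2
          rw [hg, map_zero, mul_zero]
          rintro (h | ⟨h, h'⟩)
          · exact u.2.2 h
          · exact h' h1
        · rw [zero_mul]
        · rw [zero_mul]
      · simp
      · simp
    · refine Finset.sum_eq_zero fun j _ => ?_
      rcases j with j | j | j | j | j <;> simp [ZRestrict, Z]

/-- The same argument with a left kernel vector: a row of $T_2\setminus\partial_2M$ in `s` has lost
its $Q_2$-part, but the dependency vanishes there; a row not in `s` has lost its $D_2$-entry. -/
theorem indep_base₂ (hQ₂ : G.Represents₂ Q₂) {k : ℕ} {e : Fin k ≃ G.ZRow M}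
    {f : Fin k ≃ G.ZCol M} (hdet : ((G.ZRestrict Q₁ Q₂ sgn M s).submatrix e f).det ≠ 0) :
    G.M₂.Indep (base₂ s) := by
  classical
  have : Fintype V := Fintype.ofFinite V
  let : ∀ s : Set V, Fintype s := fun s => Fintype.ofFinite s
  have hval : Subtype.val '' (Subtype.val ⁻¹' base₂ s : Set G.T₂) = base₂ s := by
    rw [Subtype.image_preimage_coe, Set.inter_eq_right.2 (base₂_subset s)]
  rw [← hval, hQ₂, linearIndepOn_iff_forall_sum_eq_zero]
  intro g hg hsum
  have hrow : ∀ u, (.inr (.inl u) : G.ZRow M) ∉ s := by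
    intro u hu
    obtain ⟨j, hj⟩ := Matrix.exists_ne_zero_of_det_submatrix_ne_zero hdet (.inr (.inl u))
    rw [zRestrict_ne_zero_iff] at hj
    exact hj.1.2 hu
  have hdet' : ((G.ZRestrict Q₁ Q₂ sgn M s).transpose.submatrix f e).det ≠ 0 := by
    rw [← Matrix.transpose_submatrix, Matrix.det_transpose]
    exact hdet
  have hw := Matrix.eq_zero_of_det_submatrix_ne_zero hdet' (w := fun
    | .inr (.inl v) => MvPolynomial.C (g ⟨v, bd₂_subset v.2⟩)
    | .inr (.inr (.inl v)) => MvPolynomial.C (g ⟨v, v.2.1⟩)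
    | _ => 0) ?_
  · intro v
    rw [← MvPolynomial.C_eq_zero (σ := Indet V)]
    by_cases hv : (v : V) ∈ G.bd₂ M
    · exact hw (.inr (.inl ⟨v, hv⟩))
    · exact hw (.inr (.inr (.inl ⟨v, v.2, hv⟩)))
  · have hg' : ∀ v : ↥(G.T₂ \ G.bd₂ M), .inr (.inr (.inl v)) ∈ s → g ⟨v, v.2.1⟩ = 0 := by
      intro v hv
      apply hg
      rintro (h | ⟨h, h'⟩)
      · exact v.2.2 h
      · exact h' hv
    rintro (l | u | u | u | u)
    · have h1 := congrArg (MvPolynomial.C (σ := Indet V)) (hsum l)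
      rw [Fintype.sum_coe_eq_sum_add_sum_sdiff (bd₂_subset (G := G) (M := M)), map_add, map_sum,
        map_sum, map_zero] at h1
      refine Eq.trans ?_ h1
      simp only [ZRestrict, Z, InDiagBlock, Matrix.transpose_apply, Matrix.of_apply,
        Fintype.sum_sum_type, hrow, mul_zero, Finset.sum_const_zero, zero_add, add_zero,
        false_iff]
      congr 1
      · refine Finset.sum_congr rfl fun v _ => ?_
        rw [if_pos not_false, map_mul, mul_comm]
      · refine Finset.sum_congr rfl fun v _ => ?_
        split_ifs with h
        · rw [hg' v h, map_zero, zero_mul, zero_mul, map_zero]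
        · rw [map_mul, mul_comm]
    · refine Finset.sum_eq_zero fun i _ => ?_
      rcases i with i | i | i | i | i <;> simp [ZRestrict, Z]
    · refine Finset.sum_eq_zero fun i _ => ?_
      rcases i with i | i | i | i | i <;> simp [ZRestrict, Z]
    · refine Finset.sum_eq_zero fun i _ => ?_
      rcases i with i | i | i | i | i
      · simp
      · simp [ZRestrict, Z]
      · simp only [ZRestrict, Z, InDiagBlock, Matrix.transpose_apply, Matrix.of_apply, true_iff]
        split_ifs with h1 h2
        · rw [hg' i h1, map_zero, mul_zero]
        · rw [zero_mul]
        · rw [zero_mul]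
      · simp
      · simp
    · refine Finset.sum_eq_zero fun i _ => ?_
      rcases i with i | i | i | i | i <;> simp [ZRestrict, Z]

end

end BPMInstance

/-! ### From a transversal to a basic path-matching -/

namespace BPMInstance

variable {V : Type*} [Finite V] {G : BPMInstance V} {F : Type*} [Field F] {M : Set (Sym2 V)}

section

variable {Q₁ : Matrix (Fin G.r) G.T₁ F} {Q₂ : Matrix G.T₂ (Fin G.r) F} {sgn : V → V → ℤˣ}
  {s : Set (G.ZRow M)} {τ : G.ZRow M ≃ G.ZCol M}

/-- The transversal sends the `r` rows of $Q_1$ to distinct columns of $T_1$. None is an uncovered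
terminal whose row is in `s`, since that row must occupy its own column through $D_1$. -/
theorem le_ncard_base₁ (hτ : ∀ i, G.ZRestrict Q₁ Q₂ sgn M s i (τ i) ≠ 0) :
    G.r ≤ (base₁ s).ncard := by
  classical
  have key : ∀ k : Fin G.r, ∃ v : base₁ s, (∃ h, τ (.inl k) = .inr (.inl ⟨v, h⟩)) ∨
      ∃ h, τ (.inl k) = .inr (.inr (.inl ⟨v, h⟩)) := by
    intro k
    have h := (zRestrict_ne_zero_iff.1 (hτ (.inl k))).2
    rcases hj : τ (.inl k) with j | v | v | j | j
    · simp [hj, Z] at h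
    · exact ⟨⟨v, Or.inl v.2⟩, Or.inl ⟨v.2, rfl⟩⟩
    · refine ⟨⟨v, Or.inr ⟨v.2, fun hs => ?_⟩⟩, Or.inr ⟨v.2, rfl⟩⟩
      have h2 := zRestrict_ne_zero_iff.1 (hτ (.inr (.inr (.inr (.inl v)))))
      have h3 := h2.1.2 hs
      rcases hx : τ (.inr (.inr (.inr (.inl v)))) with x | x | x | x | x <;> rw [hx] at h2 h3
      · exact h3
      · exact h3
      · have hvx : v = x := by
          by_contra hvx
          exact h2.2 (by simp [Z, hvx])
        rw [← hvx, ← hj] at hx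
        have := τ.injective hx
        simp at this
      · exact h3
      · exact h3
    · simp [hj, Z] at h
    · simp [hj, Z] at h
  choose g hg using key
  have hinj : Function.Injective g := by
    intro k k' hkk
    have h1 := hg k
    have h2 := hg k'
    rw [hkk] at h1
    have h3 : τ (.inl k) = τ (.inl k') := by
      rcases h1 with ⟨h, h1⟩ | ⟨h, h1⟩ <;> rcases h2 with ⟨h', h2⟩ | ⟨h', h2⟩
      · rw [h1, h2]
      · exact absurd h h'.2
      · exact absurd h' h.2
      · rw [h1, h2]
    exact Sum.inl.inj (τ.injective h3)
  have := Nat.card_le_card_of_injective g hinj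
  rwa [Nat.card_fin, Nat.card_coe_set_eq] at this

/-- The first `r` columns are met in distinct rows of $Q_2$, and an uncovered terminal serving this
way cannot have its row in `s`, where only the $D_2$-entry remains. -/
theorem le_ncard_base₂ (hτ : ∀ i, G.ZRestrict Q₁ Q₂ sgn M s i (τ i) ≠ 0) :
    G.r ≤ (base₂ s).ncard := by
  classical
  have key : ∀ k : Fin G.r, ∃ v : base₂ s, (∃ h, τ (.inr (.inl ⟨v, h⟩)) = .inl k) ∨
      ∃ h, τ (.inr (.inr (.inl ⟨v, h⟩))) = .inl k := by
    intro k
    obtain ⟨i, hi⟩ := τ.surjective (.inl k)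
    have h := zRestrict_ne_zero_iff.1 (hτ i)
    rw [hi] at h
    rcases i with i | v | v | i | i
    · simp [Z] at h
    · exact ⟨⟨v, Or.inl v.2⟩, Or.inl ⟨v.2, hi⟩⟩
    · exact ⟨⟨v, Or.inr ⟨v.2, fun hs => h.1.2 hs⟩⟩, Or.inr ⟨v.2, hi⟩⟩
    · simp [Z] at h
    · simp [Z] at h
  choose g hg using key
  have hinj : Function.Injective g := by
    intro k k' hkk
    have h1 := hg k
    have h2 := hg k'
    rw [hkk] at h1
    rcases h1 with ⟨h, h1⟩ | ⟨h, h1⟩ <;> rcases h2 with ⟨h', h2⟩ | ⟨h', h2⟩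
    · exact Sum.inl.inj (h1.symm.trans h2)
    · exact absurd h h'.2
    · exact absurd h' h.2
    · exact Sum.inl.inj (h1.symm.trans h2)
  have := Nat.card_le_card_of_injective g hinj
  rwa [Nat.card_fin, Nat.card_coe_set_eq] at this

theorem exists_isColOf {i : G.ZRow M} {j : G.ZCol M} (h : G.ZRestrict Q₁ Q₂ sgn M s i j ≠ 0)
    (hi : i ∉ s) {u : V} (hu : IsRowOf i u) : ∃ w, IsColOf j w ∧ G.graph.Adj u w := by
  rw [zRestrict_ne_zero_iff] at h
  obtain ⟨h1, h2⟩ := h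
  rw [iff_false_right hi] at h1
  rcases i with i | i | i | i | i <;> simp only [IsRowOf] at hu <;> subst hu <;>
    rcases j with j | j | j | j | j
  · exact absurd rfl h2
  · exact absurd rfl h2
  · exact absurd trivial h1
  · exact ⟨j, rfl, adj_of_X_ne_zero h2⟩
  · exact ⟨j, rfl, adj_of_X_ne_zero h2⟩
  · exact absurd rfl h2
  · exact absurd rfl h2
  · exact absurd rfl h2
  · exact ⟨j, rfl, adj_of_X_ne_zero h2⟩
  · exact ⟨j, rfl, adj_of_X_ne_zero h2⟩

theorem exists_isRowOf {i : G.ZRow M} {j : G.ZCol M} (h : G.ZRestrict Q₁ Q₂ sgn M s i j ≠ 0)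
    (hi : i ∉ s) {w : V} (hw : IsColOf j w) : ∃ u, IsRowOf i u := by
  rw [zRestrict_ne_zero_iff] at h
  obtain ⟨h1, h2⟩ := h
  rw [iff_false_right hi] at h1
  rcases j with j | j | j | j | j <;> simp only [IsColOf] at hw <;>
    rcases i with i | i | i | i | i
  · exact absurd rfl h2
  · exact absurd rfl h2
  · exact absurd trivial h1
  · exact ⟨i, rfl⟩
  · exact ⟨i, rfl⟩
  · exact absurd rfl h2
  · exact absurd rfl h2
  · exact absurd rfl h2
  · exact ⟨i, rfl⟩
  · exact ⟨i, rfl⟩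

theorem last_row_notMem (hτ : ∀ i, G.ZRestrict Q₁ Q₂ sgn M s i (τ i) ≠ 0)
    (x : ↥(G.C₁ M ∪ (G.S \ G.bdS M))) : .inr (.inr (.inr (.inr x))) ∉ s :=
  fun h => (zRestrict_ne_zero_iff.1 (hτ _)).1.2 h

/-- The successor relation that a transversal of `Z(M)` defines on the vertices that `M` leaves
open. -/
def TransversalSucc (s : Set (G.ZRow M)) (τ : G.ZRow M ≃ G.ZCol M) (u w : V) : Prop :=
  ∃ i, i ∉ s ∧ IsRowOf i u ∧ IsColOf (τ i) w

theorem exists_transversalSucc_iff (hτ : ∀ i, G.ZRestrict Q₁ Q₂ sgn M s i (τ i) ≠ 0) {u : V} :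
    (∃ w, TransversalSucc s τ u w) ↔
      (u ∈ base₁ s ∧ u ∉ G.bd₁ M) ∨ u ∈ G.C₁ M ∪ (G.S \ G.bdS M) := by
  constructor
  · rintro ⟨w, i, hi, hu, -⟩
    rcases i with i | i | i | i | i <;> simp only [IsRowOf] at hu <;> subst hu
    · exact Or.inl ⟨Or.inr ⟨i.2, hi⟩, i.2.2⟩
    · exact Or.inr i.2
  · have key : ∀ i : G.ZRow M, i ∉ s → IsRowOf i u → ∃ w, TransversalSucc s τ u w := by
      intro i hi hu
      obtain ⟨w, hw, -⟩ := exists_isColOf (hτ i) hi hu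
      exact ⟨w, i, hi, hu, hw⟩
    rintro (⟨h | ⟨h, hs⟩, h'⟩ | h)
    · exact absurd h h'
    · exact key _ hs rfl
    · exact key (.inr (.inr (.inr (.inr ⟨u, h⟩)))) (last_row_notMem hτ _) rfl

/-- The column of an uncovered $w\in T_2$ is used up by the $D_2$-entry exactly when the row of $w$
is in `s`; otherwise it must be met in the $X$-block. -/
theorem exists_transversalSucc_iff' (hτ : ∀ i, G.ZRestrict Q₁ Q₂ sgn M s i (τ i) ≠ 0) {w : V} :
    (∃ u, TransversalSucc s τ u w) ↔
      (w ∈ base₂ s ∧ w ∉ G.bd₂ M) ∨ w ∈ G.C₂ M ∪ (G.S \ G.bdS M) := by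
  -- a row in `s` that is matched to the block of `D₂`
  have hD : ∀ i ∈ s, ∀ w, IsColOf (τ i) w → ∃ h : w ∈ G.T₂ \ G.bd₂ M,
      i = .inr (.inr (.inl ⟨w, h⟩)) ∧ τ i = .inr (.inr (.inr (.inl ⟨w, h⟩))) := by
    intro i hi w hw
    have h := zRestrict_ne_zero_iff.1 (hτ i)
    have hb := h.1.2 hi
    rcases hx : τ i with x | x | x | x | x <;> rw [hx] at h hb hw <;>
      rcases i with i | i | i | i | i <;> try exact False.elim hb
    · exact False.elim hw
    · have hix : i = x := by
        by_contra hix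
        exact h.2 (by simp [Z, hix])
      have hxw : (x : V) = w := hw
      subst hxw
      exact ⟨x.2, by rw [hix], rfl⟩
  have hD' : ∀ v, .inr (.inr (.inl v)) ∈ s →
      τ (.inr (.inr (.inl v))) = .inr (.inr (.inr (.inl v))) := by
    intro v hv
    have hb := (zRestrict_ne_zero_iff.1 (hτ _)).1.2 hv
    rcases hx : τ (.inr (.inr (.inl v))) with x | x | x | x | x <;> rw [hx] at hb <;>
      try exact False.elim hb
    obtain ⟨h, h1, h2⟩ := hD _ hv x (by rw [hx]; rfl)
    simp only [Sum.inr.injEq, Sum.inl.injEq] at h1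
    rw [h1]
  constructor
  · rintro ⟨u, i, hi, hu, hw⟩
    rcases hx : τ i with x | x | x | x | x <;> rw [hx] at hw <;> try exact False.elim hw
    · have hxw : (x : V) = w := hw
      subst hxw
      refine Or.inl ⟨Or.inr ⟨x.2, fun hs => ?_⟩, x.2.2⟩
      have h1 := hD' x hs
      rw [← hx] at h1
      exact hi (τ.injective h1 ▸ hs)
    · have hxw : (x : V) = w := hw
      subst hxw
      exact Or.inr x.2
  · have key : ∀ j : G.ZCol M, IsColOf j w → τ.symm j ∉ s → ∃ u, TransversalSucc s τ u w := by
      intro j hj hs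
      have hj' : IsColOf (τ (τ.symm j)) w := by rwa [Equiv.apply_symm_apply]
      obtain ⟨u, hu⟩ := exists_isRowOf (hτ _) hs hj'
      exact ⟨u, τ.symm j, hs, hu, hj'⟩
    rintro (⟨h | ⟨h, hs⟩, h'⟩ | h)
    · exact absurd h h'
    · refine key (.inr (.inr (.inr (.inl ⟨w, h⟩)))) rfl fun h1 => ?_
      obtain ⟨h2, h3, -⟩ := hD _ h1 w (by rw [Equiv.apply_symm_apply]; rfl)
      exact hs (h3 ▸ h1)
    · refine key (.inr (.inr (.inr (.inr ⟨w, h⟩)))) rfl fun h1 => ?_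
      obtain ⟨h2, -⟩ := hD _ h1 w (by rw [Equiv.apply_symm_apply]; rfl)
      exact not_mem_S_of_mem_T₂ h2.1 (mem_S_of_mem_col h)

end

/-- The two relations have disjoint domains and disjoint ranges, so their union is a bijection. New
arcs leave level 0 or 1 and enter level 1 or above; only arcs between two uncovered vertices of $S$
stay on a level, and those are governed by `hδ`. This is why alternation is needed on
$S\setminus\partial_SM$ alone, although $C_1$ and $C_2$ may overlap the other $X$-rows and columns.
-/
theorem IsPartialPathMatching.exists_isSuccessor_of_transversal {Q₁ : Matrix (Fin G.r) G.T₁ F}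
    {Q₂ : Matrix G.T₂ (Fin G.r) F} {sgn : V → V → ℤˣ} (hM : G.IsPartialPathMatching M)
    {s : Set (G.ZRow M)} {τ : G.ZRow M ≃ G.ZCol M}
    (hτ : ∀ i, G.ZRestrict Q₁ Q₂ sgn M s i (τ i) ≠ 0) {δ : ↥(G.S \ G.bdS M) → ℕ}
    (hδ : ∀ x y : ↥(G.S \ G.bdS M),
      τ (.inr (.inr (.inr (.inr ⟨x, Or.inr x.2⟩)))) = .inr (.inr (.inr (.inr ⟨y, Or.inr y.2⟩))) →
      τ (.inr (.inr (.inr (.inr ⟨y, Or.inr y.2⟩)))) = .inr (.inr (.inr (.inr ⟨x, Or.inr x.2⟩))) ∨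
        δ x < δ y) :
    ∃ d, G.IsSuccessor (fun u w => G.Succ M u w ∨ TransversalSucc s τ u w)
      (base₁ s ∪ G.S) (base₂ s ∪ G.S) d := by
  classical
  obtain ⟨dM, hdM, hdM₁, hdM₂⟩ := G.exists_rank M
  have hR := hM.isSuccessor hdM
  have hdisj : ∀ u w w', G.Succ M u w → ¬ TransversalSucc s τ u w' := by
    intro u w w' h h'
    have h1 := (hR.dom u).1 ⟨w, h⟩
    rcases (exists_transversalSucc_iff hτ).1 ⟨w', h'⟩ with h2 | h2
    · rcases h1 with h1 | h1
      · exact h2.2 h1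
      · exact not_mem_S_of_mem_T₁ (base₁_subset s h2.1) h1.1.1
    · rcases h1 with h1 | h1
      · exact not_mem_S_of_mem_T₁ h1.1 (mem_S_of_mem_row h2)
      · rcases h2 with h2 | h2
        · exact h1.2 h2
        · exact h2.2 h1.1
  have hdisj' : ∀ u u' w, G.Succ M u w → ¬ TransversalSucc s τ u' w := by
    intro u u' w h h'
    have h1 := (hR.ran w).1 ⟨u, h⟩
    rcases (exists_transversalSucc_iff' hτ).1 ⟨u', h'⟩ with h2 | h2
    · rcases h1 with h1 | h1
      · exact h2.2 h1
      · exact not_mem_S_of_mem_T₂ (base₂_subset s h2.1) h1.1.1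
    · rcases h1 with h1 | h1
      · exact not_mem_S_of_mem_T₂ h1.1 (mem_S_of_mem_col h2)
      · rcases h2 with h2 | h2
        · exact h1.2 h2
        · exact h2.2 h1.1
  -- Uncovered vertices of $S$ go to level 1, between the old paths from $T_1$ (level 0) and those
  -- starting in $C_2$ (level 2). Uncovered terminals of $T_1$ start at 0 and those of $T_2$ end at
  -- 3.
  let d : V → ℕ ×ₗ ℕ := fun v => if ∃ e ∈ M, v ∈ e then dM v else
    if h : v ∈ G.S \ G.bdS M then toLex (1, δ ⟨v, h⟩) else
    if v ∈ G.T₁ then toLex (0, 0) else toLex (3, 0)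
  have hd_cov : ∀ v, (∃ e ∈ M, v ∈ e) → d v = dM v := fun v h => if_pos h
  have hd_free : ∀ v (h : v ∈ G.S \ G.bdS M), d v = toLex (1, δ ⟨v, h⟩) := by
    intro v h
    have h1 : ¬ ∃ e ∈ M, v ∈ e := fun h1 => h.2 ⟨h.1, h1⟩
    simp only [d, if_neg h1, dif_pos h]
  have hd_src : ∀ u w, TransversalSucc s τ u w → u ∉ G.S \ G.bdS M → (ofLex (d u)).1 = 0 := by
    intro u w h hu
    rcases (exists_transversalSucc_iff hτ).1 ⟨w, h⟩ with h1 | h1 | h1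
    · have hT := base₁_subset s h1.1
      have h2 : ¬ ∃ e ∈ M, u ∈ e := fun h2 => h1.2 ⟨hT, h2⟩
      simp only [d, if_neg h2, dif_neg hu, if_pos hT]
      rfl
    · rw [hd_cov u (C₁_subset_bdS h1).2]
      exact hdM₁ u h1
    · exact absurd h1 hu
  have hd_tgt : ∀ u w, TransversalSucc s τ u w → w ∉ G.S \ G.bdS M → 1 < (ofLex (d w)).1 := by
    intro u w h hw
    rcases (exists_transversalSucc_iff' hτ).1 ⟨u, h⟩ with h1 | h1 | h1
    · have hT := base₂_subset s h1.1
      have h2 : ¬ ∃ e ∈ M, w ∈ e := fun h2 => h1.2 ⟨hT, h2⟩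
      simp only [d, if_neg h2, dif_neg hw, if_neg (fun h => not_mem_T₂_of_mem_T₁ h hT)]
      exact (by norm_num : 1 < 3)
    · rw [hd_cov w (C₂_subset_bdS h1).2, hdM₂ w h1]
      norm_num
    · exact absurd h1 hw
  have hlt : ∀ u w, (ofLex (d u)).1 < (ofLex (d w)).1 → d u < d w := fun u w h =>
    (Prod.Lex.lt_iff).2 (Or.inl h)
  refine ⟨d, ?_, ?_, ?_, ?_, ?_, ?_⟩
  · rintro u w (h | ⟨i, hi, hu, hw⟩)
    · exact hR.adj h
    · obtain ⟨w', hw', hadj⟩ := exists_isColOf (hτ i) hi hu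
      rwa [hw.unique hw']
  · rintro u w w' (h | h) (h' | h')
    · exact h.right_unique h'
    · exact absurd h' (hdisj _ _ _ h)
    · exact absurd h (hdisj _ _ _ h')
    · obtain ⟨i, -, hu, hw⟩ := h
      obtain ⟨i', -, hu', hw'⟩ := h'
      obtain rfl := hu.row_unique hu'
      exact hw.unique hw'
  · rintro u u' w (h | h) (h' | h')
    · exact h.left_unique h'
    · exact absurd h' (hdisj' _ _ _ h)
    · exact absurd h (hdisj' _ _ _ h')
    · obtain ⟨i, -, hu, hw⟩ := h
      obtain ⟨i', -, hu', hw'⟩ := h'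
      obtain rfl := τ.injective (hw.col_unique hw')
      exact hu.unique hu'
  · intro u
    rw [exists_or, hR.dom u, exists_transversalSucc_iff hτ]
    constructor
    · rintro ((h | h) | h | h)
      · exact Or.inl (Or.inl h)
      · exact Or.inr h.1.1
      · exact Or.inl h.1
      · exact Or.inr (mem_S_of_mem_row h)
    · rintro (h | h)
      · by_cases hu : u ∈ G.bd₁ M
        · exact Or.inl (Or.inl hu)
        · exact Or.inr (Or.inl ⟨h, hu⟩)
      · by_cases hb : u ∈ G.bdS M
        · by_cases hC : u ∈ G.C₁ M
          · exact Or.inr (Or.inr (Or.inl hC))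
          · exact Or.inl (Or.inr ⟨hb, hC⟩)
        · exact Or.inr (Or.inr (Or.inr ⟨h, hb⟩))
  · intro w
    rw [exists_or, hR.ran w, exists_transversalSucc_iff' hτ]
    constructor
    · rintro ((h | h) | h | h)
      · exact Or.inl (Or.inl h)
      · exact Or.inr h.1.1
      · exact Or.inl h.1
      · exact Or.inr (mem_S_of_mem_col h)
    · rintro (h | h)
      · by_cases hu : w ∈ G.bd₂ M
        · exact Or.inl (Or.inl hu)
        · exact Or.inr (Or.inl ⟨h, hu⟩)
      · by_cases hb : w ∈ G.bdS M
        · by_cases hC : w ∈ G.C₂ M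
          · exact Or.inr (Or.inr (Or.inl hC))
          · exact Or.inl (Or.inr ⟨hb, hC⟩)
        · exact Or.inr (Or.inr (Or.inr ⟨h, hb⟩))
  · rintro u w (h | h)
    · rw [hd_cov u ⟨_, h.mem, Sym2.mem_mk_left _ _⟩, hd_cov w ⟨_, h.mem, Sym2.mem_mk_right _ _⟩]
      exact (hdM u w h).imp Or.inl id
    · by_cases hu : u ∈ G.S \ G.bdS M <;> by_cases hw : w ∈ G.S \ G.bdS M
      · obtain ⟨i, hi, hiu, hiw⟩ := h
        have hi1 : i = .inr (.inr (.inr (.inr ⟨u, Or.inr hu⟩))) := hiu.row_unique rfl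
        have hi2 : τ i = .inr (.inr (.inr (.inr ⟨w, Or.inr hw⟩))) := hiw.col_unique rfl
        rw [hi1] at hi2
        rcases hδ ⟨u, hu⟩ ⟨w, hw⟩ hi2 with h1 | h1
        · exact Or.inl (Or.inr ⟨.inr (.inr (.inr (.inr ⟨w, Or.inr hw⟩))), last_row_notMem hτ _, rfl,
            by rw [h1]; rfl⟩)
        · right
          rw [hd_free u hu, hd_free w hw, Prod.Lex.toLex_lt_toLex]
          exact Or.inr ⟨rfl, h1⟩
      · right
        apply hlt
        rw [hd_free u hu]
        exact hd_tgt u w h hw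
      · right
        apply hlt
        rw [hd_free w hw, hd_src u w h hu]
        exact Nat.one_pos
      · right
        apply hlt
        rw [hd_src u w h hu]
        exact Nat.zero_lt_of_lt (hd_tgt u w h hw)

theorem IsPartialPathMatching.isExtensible_of_isNonsingular {Q₁ : Matrix (Fin G.r) G.T₁ F}
    (hQ₁ : G.Represents₁ Q₁) {Q₂ : Matrix G.T₂ (Fin G.r) F} (hQ₂ : G.Represents₂ Q₂)
    {sgn : V → V → ℤˣ} (hsgn : G.IsSkewSign sgn) (hM : G.IsPartialPathMatching M)
    (hZ : IsNonsingular (G.Z Q₁ Q₂ sgn M)) : G.IsExtensible M := by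
  classical
  obtain ⟨k, e, f, hdet⟩ := hZ
  obtain ⟨s, hs⟩ := Matrix.exists_det_restrict_ne_zero _ InDiagBlock e f hdet
  have hs' : ((G.ZRestrict Q₁ Q₂ sgn M s).submatrix e f).det ≠ 0 := hs
  have hrow : ∀ x : ↥(G.C₁ M ∪ (G.S \ G.bdS M)), .inr (.inr (.inr (.inr x))) ∉ s := by
    intro x hx
    obtain ⟨j, hj⟩ := Matrix.exists_ne_zero_of_det_submatrix_ne_zero hs'
      (.inr (.inr (.inr (.inr x))))
    exact (zRestrict_ne_zero_iff.1 hj).1.2 hx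
  -- The restriction does not touch this block: rows in `s` keep only diagonal-block entries, and
  -- these rows have none. So it inherits the alternating form of $X$.
  have hentry : ∀ x y : ↥(G.S \ G.bdS M), G.ZRestrict Q₁ Q₂ sgn M s
      (.inr (.inr (.inr (.inr ⟨x, Or.inr x.2⟩)))) (.inr (.inr (.inr (.inr ⟨y, Or.inr y.2⟩)))) =
      G.X F sgn x y := fun x y => if_pos (iff_of_false id (hrow _))
  obtain ⟨τ, δ, hτ, hδ⟩ := Matrix.exists_equiv_of_alternating_on
    (G.ZRestrict Q₁ Q₂ sgn M s) e f hs'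
    (fun x : ↥(G.S \ G.bdS M) => .inr (.inr (.inr (.inr ⟨x, Or.inr x.2⟩))))
    (fun x : ↥(G.S \ G.bdS M) => .inr (.inr (.inr (.inr ⟨x, Or.inr x.2⟩))))
    (fun x y h => by simpa [Subtype.ext_iff] using h)
    (fun x y h => by simpa [Subtype.ext_iff] using h)
    (fun x y => by rw [hentry, hentry, X_swap hsgn x.2.1 y.2.1])
    (fun x => by rw [hentry, X_self])
  obtain ⟨d, hd⟩ := hM.exists_isSuccessor_of_transversal hτ hδ
  have hA := base₁_subset s
  have hB := base₂_subset s
  refine ⟨_, ⟨hd.isPathMatching hA hB, ?_, ?_, hd.bdS_eq⟩, ?_, ?_⟩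
  · rw [hd.bd₁_eq hA hB]
    exact (indep_base₁ hQ₁ hs').isBase_of_eRank_le_card G.rank₁ (le_ncard_base₁ hτ)
  · rw [hd.bd₂_eq hA hB]
    exact (indep_base₂ hQ₂ hs').isBase_of_eRank_le_card G.rank₂ (le_ncard_base₂ hτ)
  · intro e he
    induction e with
    | _ u w =>
      rcases hM.succ_or_succ he with h | h
      · exact ⟨u, w, Or.inl h, rfl⟩
      · exact ⟨w, u, Or.inl h, Sym2.eq_swap⟩
  · intro e he
    induction e with
    | _ u w =>
      -- A matching edge of `M` is traversed both ways by its successor relation, hence also by the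
      -- union, which makes it a matching edge of the extension.
      exact hd.mem_matchingPart hA hB (Or.inl (Or.inl he)) (Or.inl (Or.inl (Sym2.eq_swap ▸ he)))

end BPMInstance

theorem mainTheorem5 {V : Type*} [Finite V] (G : BPMInstance V)
    {F : Type*} [Field F]
    (Q₁ : Matrix (Fin G.r) G.T₁ F) (hQ₁ : G.Represents₁ Q₁)
    (Q₂ : Matrix G.T₂ (Fin G.r) F) (hQ₂ : G.Represents₂ Q₂)
    (sgn : V → V → ℤˣ) (hsgn : G.IsSkewSign sgn)
    (M : Set (Sym2 V)) (hM : G.IsPartialPathMatching M) :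
    G.IsExtensible M ↔ BPMInstance.IsNonsingular (G.Z Q₁ Q₂ sgn M) :=
  ⟨fun h => h.isNonsingular hQ₁ hQ₂ sgn hM, fun h => hM.isExtensible_of_isNonsingular hQ₁ hQ₂ hsgn h⟩
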